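/- Consider the initial value problem for the Majda-Biello system with $\alpha = 4$ and $\beta = 0$, \[ u_t + u_{xxx} = - v v_x, \qquad v_t + 4 v_{xxx} = -(uv)_x, \qquad (u,v)|_{t=0} = (u_0,v_0) \in H^s(\mathbb{R}) \times H^s(\mathbb{R}), \qquad x \in \mathbb{R}. \] For every real $s < \frac34$ this problem fails to be $C^2$ locally well-posed in $H^s(\mathbb{R})\times H^s(\mathbb{R})$, both for real-valued and for complex-valued functions. Here the problem is called $C^2$ locally well-posed in $H^s(\mathbb{R})\times H^s(\mathbb{R})$ if every $w_0 \in H^s(\mathbb{R})\times H^s(\mathbb{R})$ has an open neighbourhood $U$ and a time $T>0$ such that for each $(u_0,v_0) \in U$ there is exactly one solution $(u,v) \in C([0,T]; H^s(\mathbb{R})\times H^s(\mathbb{R}))$ with these initial data, and the map $(u_0,v_0) \mapsto (u,v)$ from $U$ to $C([0,T]; H^s(\mathbb{R})\times H^s(\mathbb{R}))$ is twice continuously (Fréchet) differentiable over $\mathbb{R}$; solutions in $C([0,T]; H^s(\mathbb{R})\times H^s(\mathbb{R}))$ are the limits, in this space, of smooth solutions on $[0,T]\times\mathbb{R}$ that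 belong to $C([0,T]; H^\sigma(\mathbb{R})\times H^\sigma(\mathbb{R}))$ for every real $\sigma$. -/

import Mathlib

open MeasureTheory Set Topology
open scoped SchwartzMap ContDiff

noncomputable section

namespace MajdaBiello

/-- A tempered distribution is `𝔽`-valued if it maps real-valued test functions into `𝔽`.
The only subalgebras of `ℂ` over `ℝ` are `⊥` (the real numbers) and `⊤` (all of `ℂ`), so this
covers real-valued distributions (`𝔽 = ⊥`) and arbitrary complex ones (`𝔽 = ⊤`). -/
def IsValuedIn (𝔽 : Subalgebra ℝ ℂ) (f : 𝓢'(ℝ, ℂ)) : Prop :=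
  ∀ g : 𝓢(ℝ, ℂ), (∀ x, (g x).im = 0) → f g ∈ 𝔽

/-- The `𝔽`-valued tempered distributions `f` on the line with `(1 + |ξ|²)^(s/2) 𝓕 f ∈ L²`. -/
def sobolevSubmodule (𝔽 : Subalgebra ℝ ℂ) (s : ℝ) : Submodule ℝ 𝓢'(ℝ, ℂ) where
  carrier := {f | TemperedDistribution.MemSobolev s 2 f ∧ IsValuedIn 𝔽 f}
  zero_mem' := ⟨TemperedDistribution.memSobolev_fun_zero ℝ ℂ s 2, fun _ _ => 𝔽.zero_mem⟩
  add_mem' := fun hf hg => ⟨hf.1.add hg.1, fun g h => 𝔽.add_mem (hf.2 g h) (hg.2 g h)⟩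
  smul_mem' := fun c f hf =>
    ⟨by simpa using hf.1.smul (c : ℂ), fun g h => 𝔽.smul_mem (hf.2 g h) c⟩

/-- The Sobolev space `H^s(ℝ)` of `𝔽`-valued tempered distributions (`𝔽 = ℝ` or `ℂ`). -/
def SobolevSpace (𝔽 : Subalgebra ℝ ℂ) (s : ℝ) : Type := sobolevSubmodule 𝔽 s

namespace SobolevSpace

variable {𝔽 : Subalgebra ℝ ℂ} {s : ℝ}

instance : AddCommGroup (SobolevSpace 𝔽 s) := inferInstanceAs (AddCommGroup (sobolevSubmodule 𝔽 s))

instance : Module ℝ (SobolevSpace 𝔽 s) := inferInstanceAs (Module ℝ (sobolevSubmodule 𝔽 s))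

/-- The underlying tempered distribution. -/
def toDistribution (f : SobolevSpace 𝔽 s) : 𝓢'(ℝ, ℂ) := f.1

theorem exists_bessel (f : SobolevSpace 𝔽 s) : ∃ g : Lp ℂ 2 (volume : Measure ℝ),
    TemperedDistribution.besselPotential ℝ ℂ s f.toDistribution
      = Lp.toTemperedDistributionCLM ℂ volume 2 g := f.2.1

theorem toTempered_injective :
    Function.Injective (Lp.toTemperedDistributionCLM ℂ (volume : Measure ℝ) 2) :=
  LinearMap.ker_eq_bot.mp
    (Lp.ker_toTemperedDistributionCLM_eq_bot (F := ℂ) (μ := (volume : Measure ℝ)) (p := 2))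

/-- The map `f ↦ 𝓕⁻¹ (1 + |ξ|²)^(s/2) 𝓕 f` from `H^s` to `L²`. -/
def bessel : SobolevSpace 𝔽 s →ₗ[ℝ] Lp ℂ 2 (volume : Measure ℝ) where
  toFun f := (exists_bessel f).choose
  map_add' f g := by
    apply toTempered_injective
    rw [map_add, ← (exists_bessel f).choose_spec, ← (exists_bessel g).choose_spec,
      ← (exists_bessel (f + g)).choose_spec, ← map_add]
    rfl
  map_smul' c f := by
    apply toTempered_injective
    rw [RingHom.id_apply, ContinuousLinearMap.map_smul_of_tower,
      ← (exists_bessel f).choose_spec, ← (exists_bessel (c • f)).choose_spec,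
      ← ContinuousLinearMap.map_smul_of_tower]
    rfl

theorem bessel_spec (f : SobolevSpace 𝔽 s) :
    TemperedDistribution.besselPotential ℝ ℂ s f.toDistribution
      = Lp.toTemperedDistributionCLM ℂ volume 2 (bessel f) := (exists_bessel f).choose_spec

theorem bessel_injective : Function.Injective (bessel : SobolevSpace 𝔽 s →ₗ[ℝ] _) := by
  intro f g h
  have h1 : TemperedDistribution.besselPotential ℝ ℂ s f.toDistribution
      = TemperedDistribution.besselPotential ℝ ℂ s g.toDistribution := by
    rw [bessel_spec, bessel_spec, h]
  have h2 := congrArg (TemperedDistribution.besselPotential ℝ ℂ (-s)) h1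
  simp only [TemperedDistribution.besselPotential_besselPotential_apply, add_neg_cancel,
    TemperedDistribution.besselPotential_zero, ContinuousLinearMap.id_apply] at h2
  exact Subtype.ext h2

/-- The norm of `H^s` is `‖f‖ = ‖(1 + |ξ|²)^(s/2) 𝓕 f‖_{L²} = ‖𝓕⁻¹ (1 + |ξ|²)^(s/2) 𝓕 f‖_{L²}`. -/
instance : NormedAddCommGroup (SobolevSpace 𝔽 s) :=
  NormedAddCommGroup.induced _ _ (bessel : SobolevSpace 𝔽 s →ₗ[ℝ] _) bessel_injective

instance : NormedSpace ℝ (SobolevSpace 𝔽 s) :=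
  NormedSpace.induced ℝ _ _ (bessel : SobolevSpace 𝔽 s →ₗ[ℝ] _)

/-- The element `f` of `H^s` is given by the square integrable function `g`. -/
def IsGivenBy (f : SobolevSpace 𝔽 s) (g : ℝ → ℂ) : Prop :=
  ∃ h : MemLp g 2 volume, f.toDistribution = Lp.toTemperedDistributionCLM ℂ volume 2 (h.toLp g)

end SobolevSpace

/-- The data space `H^s(ℝ) × H^s(ℝ)`. -/
abbrev DataSpace (𝔽 : Subalgebra ℝ ℂ) (s : ℝ) : Type := SobolevSpace 𝔽 s × SobolevSpace 𝔽 s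

/-- The space `C([0,T]; H^s(ℝ) × H^s(ℝ))`, with the supremum norm. -/
abbrev PathSpace (𝔽 : Subalgebra ℝ ℂ) (s T : ℝ) : Type := C(Icc (0 : ℝ) T, DataSpace 𝔽 s)

/-- The path `w` in `H^s × H^s` is given by the pair of functions `u t x`, `v t x`. -/
def PathIsGivenBy {𝔽 : Subalgebra ℝ ℂ} {s T : ℝ} (w : PathSpace 𝔽 s T) (u v : ℝ → ℝ → ℂ) : Prop :=
  ∀ t : Icc (0 : ℝ) T, (w t).1.IsGivenBy (u t) ∧ (w t).2.IsGivenBy (v t)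

/-- `(u, v)` is a smooth solution on `[0,T] × ℝ`, continuous in time with values in every
Sobolev space, of
`u_t + u_xxx = - v v_x`, `v_t + α v_xxx + β v_x = - (u v)_x`. -/
structure IsSmoothSolution (𝔽 : Subalgebra ℝ ℂ) (α β T : ℝ) (u v : ℝ → ℝ → ℂ) : Prop where
  smooth_u : ∀ t ∈ Icc 0 T, ContDiff ℝ ∞ (u t)
  smooth_v : ∀ t ∈ Icc 0 T, ContDiff ℝ ∞ (v t)
  continuous_sobolev : ∀ σ : ℝ, ∃ w : PathSpace 𝔽 σ T, PathIsGivenBy w u v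
  eq_u : ∀ t ∈ Icc 0 T, ∀ x, HasDerivWithinAt (fun τ => u τ x)
    (-iteratedDeriv 3 (u t) x - v t x * deriv (v t) x) (Icc 0 T) t
  eq_v : ∀ t ∈ Icc 0 T, ∀ x, HasDerivWithinAt (fun τ => v τ x)
    (-(α * iteratedDeriv 3 (v t) x) - β * deriv (v t) x - deriv (fun y => u t y * v t y) x)
    (Icc 0 T) t

/-- Solutions in `C([0,T]; H^s × H^s)`: the limits, in this space, of smooth solutions. This has
a meaning for every real `s`, also where the products in the equations cannot be formed directly;
for `s ≥ 0` such a limit satisfies the equations in the sense of distributions. -/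
def IsSolution {𝔽 : Subalgebra ℝ ℂ} {s T : ℝ} (α β : ℝ) (w : PathSpace 𝔽 s T) : Prop :=
  w ∈ closure {z : PathSpace 𝔽 s T | ∃ u v, IsSmoothSolution 𝔽 α β T u v ∧ PathIsGivenBy z u v}

/-- Local well-posedness in `H^s × H^s` with a `C^k` solution map: near every initial datum there
are a common time of existence `T > 0` and, for every datum, exactly one solution in
`C([0,T]; H^s × H^s)`, and the map from the data to the solutions is `C^k`. -/
def IsLocallyWellPosed (k : WithTop ℕ∞) (𝔽 : Subalgebra ℝ ℂ) (α β s : ℝ) : Prop :=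
  ∀ w₀ : DataSpace 𝔽 s, ∃ (T : ℝ) (hT : 0 < T) (U : Set (DataSpace 𝔽 s))
    (Φ : DataSpace 𝔽 s → PathSpace 𝔽 s T), IsOpen U ∧ w₀ ∈ U ∧
    (∀ f ∈ U, IsSolution α β (Φ f) ∧ Φ f ⟨0, left_mem_Icc.mpr hT.le⟩ = f ∧
      ∀ w : PathSpace 𝔽 s T, IsSolution α β w → w ⟨0, left_mem_Icc.mpr hT.le⟩ = f → w = Φ f) ∧
    ContDiffOn ℝ k Φ U

end MajdaBiello

end

open scoped BoundedContinuousFunction ComplexConjugate FourierTransform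

/-! A `C²` solution map near zero data forces its quadratic Taylor term, the second Picard iterate,
to be bounded by the square of the data norm in `H^s`. For `s < 3/4` data concentrated near a
resonance violate this.

For `α = 4` the interaction of two `v`-waves of frequencies `η` and `ξ - η` into a `u`-wave of
frequency `ξ` has phase `4η³ + 4(ξ - η)³ - ξ³ = 3ξ(ξ - 2η)²` (`airy_product`), with a double zero at
`η = ξ/2`. Take `u₀ = 0` and let the Fourier transform of `v₀` be a pair of bumps of width `δ` at
`±N`. With `N δ²` a small constant depending on `T`, the phase stays bounded up to time `T`, nothing
cancels, and the iterate has size of order `T N δ` on a window of width `δ` about `2N`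
(`le_norm_duhamel`). The quadratic bound then reads `N^(2s) T² N² δ³ ≲ (N^(2s) δ)²`. For `δ ~
N^(-1/2)` this says `N^(3/2) ≲ N^(2s)`, which fails for large `N` (`exists_large_frequency`). The
data are real-valued, so real and complex scalars are treated together.

The solution map is known only through uniqueness among limits of smooth solutions, so genuine
smooth solutions with data `ε • f` must be produced on the given interval `[0, T]`. They are built
among analytic functions: the Fourier coefficients are controlled by a weight whose exponential rate
decreases in time, and this loss of analyticity radius pays for the derivative in the nonlinearity
(`integral_abs_mul_wt_le`). The Duhamel form is then a bounded bilinear map, the inverse function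
theorem gives solutions for small `ε` with their expansion to third order
(`exists_solution_expansion`), and comparing this with the Taylor expansion of the solution map
bounds the iterate (`exists_quadratic_bound`, `IsLocallyWellPosed.exists_quadratic_estimate`). -/

namespace MajdaBiello

/-! ### Analytic weights and convolution estimates -/

section

/-- The projection of the line onto `[0, T]`. -/
noncomputable def clamp (T t : ℝ) : ℝ := max 0 (min t T)

theorem continuous_clamp (T : ℝ) : Continuous (clamp T) := by
  unfold clamp; fun_prop

theorem clamp_nonneg (T t : ℝ) : 0 ≤ clamp T t := le_max_left _ _

theorem clamp_le {T : ℝ} (hT : 0 ≤ T) (t : ℝ) : clamp T t ≤ T := max_le hT (min_le_right _ _)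

theorem clamp_of_mem {T t : ℝ} (ht : t ∈ Icc 0 T) : clamp T t = t := by
  rw [clamp, min_eq_left ht.2, max_eq_right ht.1]

/-- A weight on the frequency side whose exponential rate decreases linearly in time. -/
noncomputable def wt (T t ξ : ℝ) : ℝ := Real.exp (-(1 + T - clamp T t) * |ξ|) / (1 + ξ ^ 2)

theorem wt_pos (T t ξ : ℝ) : 0 < wt T t ξ := by unfold wt; positivity

theorem continuous_wt (T : ℝ) : Continuous fun p : ℝ × ℝ => wt T p.1 p.2 := by
  unfold wt
  have := continuous_clamp T
  refine Continuous.div (by fun_prop) (by fun_prop) fun p => by positivity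

theorem wt_neg (T t ξ : ℝ) : wt T t (-ξ) = wt T t ξ := by simp [wt]

theorem wt_le_inv {T : ℝ} (hT : 0 ≤ T) (t ξ : ℝ) : wt T t ξ ≤ (1 + ξ ^ 2)⁻¹ := by
  rw [wt, div_eq_mul_inv]
  refine mul_le_of_le_one_left (by positivity) (Real.exp_le_one_iff.mpr ?_)
  nlinarith [clamp_le hT t, abs_nonneg ξ]

/-- The exponential rate never drops below `1`; this reserve places every time slice in all Sobolev
spaces. -/
theorem wt_le_exp {T : ℝ} (hT : 0 ≤ T) (t ξ : ℝ) : wt T t ξ ≤ Real.exp (-|ξ|) := by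
  rw [wt]
  refine (div_le_self (Real.exp_pos _).le (by nlinarith [sq_nonneg ξ])).trans ?_
  refine Real.exp_le_exp.mpr ?_
  nlinarith [clamp_le hT t, abs_nonneg ξ]

/-- The exponentials multiply by the triangle inequality, and the rational factors by `1 + ξ² ≤ 2(1
+ η²) + 2(1 + (ξ - η)²)`. The last factor has an integral in `η` independent of `ξ`, so domination
by the weight survives convolution. -/
theorem wt_mul_wt_le {T : ℝ} (hT : 0 ≤ T) (t ξ η : ℝ) :
    wt T t η * wt T t (ξ - η) ≤ wt T t ξ * (2 * (1 + η ^ 2)⁻¹ + 2 * (1 + (ξ - η) ^ 2)⁻¹) := by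
  have hexp : Real.exp (-(1 + T - clamp T t) * |η|) * Real.exp (-(1 + T - clamp T t) * |ξ - η|)
      ≤ Real.exp (-(1 + T - clamp T t) * |ξ|) := by
    rw [← Real.exp_add]
    refine Real.exp_le_exp.mpr ?_
    have h : |ξ| ≤ |η| + |ξ - η| := by simpa using abs_add_le η (ξ - η)
    nlinarith [clamp_le hT t]
  have hrat : ((1 + η ^ 2) * (1 + (ξ - η) ^ 2))⁻¹
      ≤ (1 + ξ ^ 2)⁻¹ * (2 * (1 + η ^ 2)⁻¹ + 2 * (1 + (ξ - η) ^ 2)⁻¹) := by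
    have h1 : 0 < 1 + η ^ 2 := by positivity
    have h2 : 0 < 1 + (ξ - η) ^ 2 := by positivity
    have h3 : 0 < 1 + ξ ^ 2 := by positivity
    rw [show (1 + ξ ^ 2)⁻¹ * (2 * (1 + η ^ 2)⁻¹ + 2 * (1 + (ξ - η) ^ 2)⁻¹)
      = (2 * (1 + η ^ 2) + 2 * (1 + (ξ - η) ^ 2)) / (1 + ξ ^ 2)
        * ((1 + η ^ 2) * (1 + (ξ - η) ^ 2))⁻¹ by field_simp; ring]
    refine le_mul_of_one_le_left (by positivity) ?_
    rw [one_le_div h3]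
    nlinarith [sq_nonneg (2 * η - ξ)]
  have := mul_le_mul hexp hrat (by positivity) (by positivity)
  simp only [wt]
  calc _ = _ := by field_simp
    _ ≤ _ := this
    _ = _ := by ring

theorem integrable_inv_one_add_sq_sub (ξ : ℝ) :
    Integrable fun η : ℝ => (1 + (ξ - η) ^ 2)⁻¹ :=
  integrable_inv_one_add_sq.comp_sub_left ξ

theorem integral_bound (ξ : ℝ) :
    ∫ η : ℝ, (2 * (1 + η ^ 2)⁻¹ + 2 * (1 + (ξ - η) ^ 2)⁻¹) = 4 * Real.pi := by
  rw [integral_add (integrable_inv_one_add_sq.const_mul _)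
    ((integrable_inv_one_add_sq_sub ξ).const_mul _), integral_const_mul, integral_const_mul,
    integral_sub_left_eq_self (fun η : ℝ => (1 + η ^ 2)⁻¹) volume ξ,
    integral_univ_inv_one_add_sq]
  ring

/-- Bounded continuous functions of time and frequency. -/
abbrev Amp : Type := BoundedContinuousFunction (ℝ × ℝ) ℂ

/-- The Fourier coefficient with normalized amplitude `A`. -/
noncomputable def coef (T : ℝ) (A : Amp) (t ξ : ℝ) : ℂ := (wt T t ξ : ℂ) * A (t, ξ)

variable {T : ℝ}

theorem continuous_coef (A : Amp) : Continuous fun p : ℝ × ℝ => coef T A p.1 p.2 := by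
  unfold coef
  have := continuous_wt T
  have := A.continuous
  fun_prop

theorem norm_coef_le (A : Amp) (t ξ : ℝ) : ‖coef T A t ξ‖ ≤ ‖A‖ * wt T t ξ := by
  rw [coef, norm_mul, Complex.norm_real, Real.norm_of_nonneg (wt_pos T t ξ).le, mul_comm]
  exact mul_le_mul_of_nonneg_right (A.norm_coe_le_norm _) (wt_pos T t ξ).le

theorem norm_coef_mul_coef_le (hT : 0 ≤ T) (A B : Amp) (t ξ η : ℝ) :
    ‖coef T A t η * coef T B t (ξ - η)‖ ≤
      (‖A‖ * ‖B‖ * wt T t ξ) * (2 * (1 + η ^ 2)⁻¹ + 2 * (1 + (ξ - η) ^ 2)⁻¹) := by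
  rw [norm_mul]
  have h1 := mul_le_mul (norm_coef_le (T := T) A t η) (norm_coef_le (T := T) B t (ξ - η))
    (norm_nonneg _) (mul_nonneg (norm_nonneg _) (wt_pos T t η).le)
  have h2 := mul_le_mul_of_nonneg_left (wt_mul_wt_le hT t ξ η)
    (mul_nonneg (norm_nonneg A) (norm_nonneg B))
  linarith

theorem integrable_coef_mul_coef (hT : 0 ≤ T) (A B : Amp) (t ξ : ℝ) :
    Integrable fun η => coef T A t η * coef T B t (ξ - η) := by
  refine Integrable.mono' (((integrable_inv_one_add_sq.const_mul 2).add
    ((integrable_inv_one_add_sq_sub ξ).const_mul 2)).const_mul (‖A‖ * ‖B‖ * wt T t ξ)) ?_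
    (Filter.Eventually.of_forall fun η => norm_coef_mul_coef_le hT A B t ξ η)
  have h1 := (continuous_coef (T := T) A).comp
    (by fun_prop : Continuous fun η : ℝ => (t, η))
  have h2 := (continuous_coef (T := T) B).comp
    (by fun_prop : Continuous fun η : ℝ => (t, ξ - η))
  exact (h1.mul h2).aestronglyMeasurable

/-- The convolution in frequency of two coefficients. -/
noncomputable def conv (T : ℝ) (A B : Amp) (t ξ : ℝ) : ℂ :=
  ∫ η, coef T A t η * coef T B t (ξ - η)

theorem norm_conv_le (hT : 0 ≤ T) (A B : Amp) (t ξ : ℝ) :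
    ‖conv T A B t ξ‖ ≤ 4 * Real.pi * (‖A‖ * ‖B‖) * wt T t ξ := by
  refine (norm_integral_le_of_norm_le (((integrable_inv_one_add_sq.const_mul 2).add
    ((integrable_inv_one_add_sq_sub ξ).const_mul 2)).const_mul (‖A‖ * ‖B‖ * wt T t ξ))
    (Filter.Eventually.of_forall fun η => norm_coef_mul_coef_le hT A B t ξ η)).trans_eq ?_
  rw [integral_const_mul]
  have := integral_bound ξ
  simp only [Pi.add_apply]
  rw [this]; ring

theorem continuous_conv (hT : 0 ≤ T) (A B : Amp) :
    Continuous fun p : ℝ × ℝ => conv T A B p.1 p.2 := by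
  unfold conv
  -- The majorant may not depend on `p`, so all decay is taken from the first factor and the second
  -- is merely bounded.
  refine continuous_of_dominated (bound := fun η => ‖A‖ * ‖B‖ * (1 + η ^ 2)⁻¹) ?_ ?_ ?_ ?_
  · intro p
    exact (integrable_coef_mul_coef hT A B p.1 p.2).aestronglyMeasurable
  · intro p
    refine Filter.Eventually.of_forall fun η => ?_
    rw [norm_mul]
    have h1 : ‖coef T A p.1 η‖ ≤ ‖A‖ * (1 + η ^ 2)⁻¹ := (norm_coef_le A _ _).trans
      (mul_le_mul_of_nonneg_left (wt_le_inv hT _ _) (norm_nonneg _))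
    have h2 : ‖coef T B p.1 (p.2 - η)‖ ≤ ‖B‖ * 1 := (norm_coef_le B _ _).trans
      (mul_le_mul_of_nonneg_left ((wt_le_inv hT _ _).trans (inv_le_one_of_one_le₀ (by
        nlinarith [sq_nonneg (p.2 - η)]))) (norm_nonneg _))
    refine (mul_le_mul h1 h2 (norm_nonneg _) (by positivity)).trans_eq (by ring)
  · exact integrable_inv_one_add_sq.const_mul _
  · refine Filter.Eventually.of_forall fun η => ?_
    have h1 := (continuous_coef (T := T) A).comp
      (by fun_prop : Continuous fun p : ℝ × ℝ => (p.1, η))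
    have h2 := (continuous_coef (T := T) B).comp
      (by fun_prop : Continuous fun p : ℝ × ℝ => (p.1, p.2 - η))
    exact h1.mul h2

/-! ### Airy propagator and Duhamel integral -/

/-- The phase `(2 π ξ)³`. -/
noncomputable def cube (ξ : ℝ) : ℝ := (2 * Real.pi * ξ) ^ 3

theorem continuous_cube : Continuous cube := by unfold cube; fun_prop

theorem cube_neg (ξ : ℝ) : cube (-ξ) = -cube ξ := by unfold cube; ring

/-- The Airy propagator with dispersion coefficient `c`. -/
noncomputable def airy (c t ξ : ℝ) : ℂ := Complex.exp (((c * cube ξ * t : ℝ) : ℂ) * Complex.I)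

theorem continuous_airy (c : ℝ) : Continuous fun p : ℝ × ℝ => airy c p.1 p.2 := by
  unfold airy
  have := continuous_cube
  fun_prop

theorem norm_airy (c t ξ : ℝ) : ‖airy c t ξ‖ = 1 := Complex.norm_exp_ofReal_mul_I _

theorem airy_zero (c ξ : ℝ) : airy c 0 ξ = 1 := by simp [airy]

theorem airy_neg (c t ξ : ℝ) : airy c t (-ξ) = conj (airy c t ξ) := by
  rw [airy, airy, ← Complex.exp_conj, cube_neg]
  simp

theorem airy_add (c t t' ξ : ℝ) : airy c (t + t') ξ = airy c t ξ * airy c t' ξ := by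
  rw [airy, airy, airy, ← Complex.exp_add]
  congr 1; push_cast; ring

theorem hasDerivAt_airy (c t ξ : ℝ) :
    HasDerivAt (fun t => airy c t ξ) (c * cube ξ * Complex.I * airy c t ξ) t := by
  unfold airy
  have h : HasDerivAt (fun t : ℝ => (((c * cube ξ * t : ℝ) : ℂ) * Complex.I))
      (((c * cube ξ * 1 : ℝ) : ℂ) * Complex.I) t :=
    (((hasDerivAt_id t).const_mul (c * cube ξ)).ofReal_comp).mul_const _
  convert! h.cexp using 1
  push_cast; ring

/-- The Fourier transform of `-∂ₓ` of the product. -/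
noncomputable def src (T : ℝ) (A B : Amp) (t ξ : ℝ) : ℂ :=
  -(2 * Real.pi * ξ * Complex.I) * conv T A B t ξ

theorem continuous_src (hT : 0 ≤ T) (A B : Amp) :
    Continuous fun p : ℝ × ℝ => src T A B p.1 p.2 := by
  unfold src
  have := continuous_conv hT A B
  fun_prop

theorem norm_src_le (hT : 0 ≤ T) (A B : Amp) (t ξ : ℝ) :
    ‖src T A B t ξ‖ ≤ 8 * Real.pi ^ 2 * (‖A‖ * ‖B‖) * (|ξ| * wt T t ξ) := by
  have h : ‖-(2 * Real.pi * ξ * Complex.I : ℂ)‖ = 2 * Real.pi * |ξ| := by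
    simp [abs_of_pos Real.pi_pos]
  rw [src, norm_mul, h]
  refine (mul_le_mul_of_nonneg_left (norm_conv_le hT A B t ξ) (by positivity)).trans_eq (by ring)

/-- The Duhamel integral. -/
noncomputable def duhamel (T c : ℝ) (A B : Amp) (t ξ : ℝ) : ℂ :=
  ∫ τ in (0 : ℝ)..t, airy c (t - τ) ξ * src T A B τ ξ

theorem continuous_duhamel (hT : 0 ≤ T) (c : ℝ) (A B : Amp) :
    Continuous fun p : ℝ × ℝ => duhamel T c A B p.1 p.2 := by
  unfold duhamel
  refine intervalIntegral.continuous_parametric_intervalIntegral_of_continuous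
    (f := fun (p : ℝ × ℝ) τ => airy c (p.1 - τ) p.2 * src T A B τ p.2) ?_ continuous_fst
  have h1 := (continuous_airy c).comp
    (by fun_prop : Continuous fun q : (ℝ × ℝ) × ℝ => (q.1.1 - q.2, q.1.2))
  have h2 := (continuous_src hT A B).comp
    (by fun_prop : Continuous fun q : (ℝ × ℝ) × ℝ => (q.2, q.1.2))
  exact h1.mul h2

/-- On `[0, T]` the integrand is the time derivative of the weight, so the integral telescopes. This
recovers the derivative lost in the nonlinearity. -/
theorem integral_abs_mul_wt_le {t : ℝ} (ht : t ∈ Icc 0 T) (ξ : ℝ) :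
    ∫ τ in (0 : ℝ)..t, |ξ| * wt T τ ξ ≤ wt T t ξ := by
  have hF : ∀ τ : ℝ, HasDerivAt
      (fun τ => Real.exp (-(1 + T - τ) * |ξ|) / (1 + ξ ^ 2))
      (|ξ| * (Real.exp (-(1 + T - τ) * |ξ|) / (1 + ξ ^ 2))) τ := by
    intro τ
    have h : HasDerivAt (fun τ : ℝ => -(1 + T - τ) * |ξ|) (-(0 - 1) * |ξ|) τ := by
      simpa using (((hasDerivAt_id τ).const_sub (1 + T)).neg).mul_const |ξ|
    convert! (h.exp).div_const (1 + ξ ^ 2) using 1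
    ring
  have hcongr : ∫ τ in (0 : ℝ)..t, |ξ| * wt T τ ξ
      = ∫ τ in (0 : ℝ)..t, |ξ| * (Real.exp (-(1 + T - τ) * |ξ|) / (1 + ξ ^ 2)) := by
    refine intervalIntegral.integral_congr fun τ hτ => ?_
    rw [uIcc_of_le ht.1] at hτ
    simp only [wt, clamp_of_mem (show τ ∈ Icc 0 T from ⟨hτ.1, hτ.2.trans ht.2⟩)]
  rw [hcongr, intervalIntegral.integral_eq_sub_of_hasDerivAt (fun τ _ => hF τ)
    (Continuous.intervalIntegrable (by fun_prop) _ _), wt, clamp_of_mem ht]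
  have : 0 < Real.exp (-(1 + T - 0) * |ξ|) / (1 + ξ ^ 2) := by positivity
  linarith

theorem norm_duhamel_le (hT : 0 ≤ T) (c : ℝ) (A B : Amp) {t : ℝ} (ht : t ∈ Icc 0 T) (ξ : ℝ) :
    ‖duhamel T c A B t ξ‖ ≤ 8 * Real.pi ^ 2 * (‖A‖ * ‖B‖) * wt T t ξ := by
  have hc : Continuous fun τ : ℝ => |ξ| * wt T τ ξ := continuous_const.mul
    ((continuous_wt T).comp (by fun_prop : Continuous fun τ : ℝ => (τ, ξ)))
  have h := intervalIntegral.norm_integral_le_of_norm_le (a := 0) (b := t) (μ := volume)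
    (f := fun τ => airy c (t - τ) ξ * src T A B τ ξ)
    (g := fun τ => 8 * Real.pi ^ 2 * (‖A‖ * ‖B‖) * (|ξ| * wt T τ ξ)) ht.1
    (Filter.Eventually.of_forall fun τ _ => by
      rw [norm_mul, norm_airy, one_mul]; exact norm_src_le hT A B τ ξ)
    ((hc.const_mul _).intervalIntegrable _ _)
  refine h.trans ?_
  rw [intervalIntegral.integral_const_mul]
  exact mul_le_mul_of_nonneg_left (integral_abs_mul_wt_le ht ξ) (by positivity)

/-! ### Hermitian amplitudes -/

/-- The amplitudes of real-valued functions. -/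
def realAmp : Submodule ℝ Amp where
  carrier := {A | ∀ t ξ, A (t, -ξ) = conj (A (t, ξ))}
  zero_mem' := by simp
  add_mem' := fun hA hB t ξ => by simp [hA t ξ, hB t ξ]
  smul_mem' := fun c A hA t ξ => by simp [hA t ξ]

theorem isClosed_realAmp : IsClosed (realAmp : Set Amp) := by
  have : (realAmp : Set Amp) = ⋂ (t : ℝ) (ξ : ℝ), {A : Amp | A (t, -ξ) = conj (A (t, ξ))} := by
    ext A
    simp only [mem_iInter, mem_ofPred_eq]
    rfl
  rw [this]
  refine isClosed_iInter fun t => isClosed_iInter fun ξ => isClosed_eq ?_ ?_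
  · exact (BoundedContinuousFunction.evalCLM ℝ (t, -ξ) (β := ℂ)).continuous
  · exact Complex.continuous_conj.comp
      (BoundedContinuousFunction.evalCLM ℝ (t, ξ) (β := ℂ)).continuous

/-- Completeness is required by the inverse function theorem in `exists_solution_expansion`. -/
instance : CompleteSpace realAmp := isClosed_realAmp.completeSpace_coe

theorem coef_neg (A : realAmp) (t ξ : ℝ) : coef T A t (-ξ) = conj (coef T A t ξ) := by
  simp [coef, wt_neg, A.2 t ξ]

theorem conv_neg (A B : realAmp) (t ξ : ℝ) : conv T A B t (-ξ) = conj (conv T A B t ξ) := by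
  rw [conv, conv, ← integral_conj, ← integral_neg_eq_self]
  refine integral_congr_ae (Filter.Eventually.of_forall fun η => ?_)
  simp only [map_mul, ← coef_neg]
  congr 2; ring

theorem src_neg (A B : realAmp) (t ξ : ℝ) : src T A B t (-ξ) = conj (src T A B t ξ) := by
  rw [src, src, conv_neg]
  simp [Complex.conj_ofNat]

theorem intervalIntegral_conj (f : ℝ → ℂ) (a b : ℝ) :
    ∫ τ in a..b, conj (f τ) = conj (∫ τ in a..b, f τ) := by
  simp only [intervalIntegral, integral_conj, map_sub]

theorem duhamel_neg (c : ℝ) (A B : realAmp) (t ξ : ℝ) :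
    duhamel T c A B t (-ξ) = conj (duhamel T c A B t ξ) := by
  rw [duhamel, duhamel, ← intervalIntegral_conj]
  simp only [map_mul, src_neg, airy_neg]

/-- Functions of time and frequency that are dominated by the weight on `[0, T]`, normalized. -/
noncomputable def ofBound (T : ℝ) (hT : 0 ≤ T) (f : ℝ → ℝ → ℂ)
    (hf : Continuous fun p : ℝ × ℝ => f p.1 p.2)
    (M : ℝ) (hM : ∀ t ∈ Icc 0 T, ∀ ξ, ‖f t ξ‖ ≤ M * wt T t ξ) : Amp :=
  BoundedContinuousFunction.ofNormedAddCommGroup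
    -- Freezing time outside `[0, T]` makes the bound on `[0, T]` sufficient for global boundedness.
    (fun p : ℝ × ℝ => ((wt T p.1 p.2 : ℝ) : ℂ)⁻¹ * f (clamp T p.1) p.2)
    (by
      have h1 := continuous_wt T
      have h2 := hf.comp (((continuous_clamp T).comp continuous_fst).prodMk continuous_snd :
        Continuous fun p : ℝ × ℝ => (clamp T p.1, p.2))
      refine Continuous.mul (Continuous.inv₀ (by fun_prop) fun p => ?_) h2
      exact_mod_cast (wt_pos T p.1 p.2).ne')
    M (fun p => by
      have hmem : clamp T p.1 ∈ Icc 0 T := ⟨clamp_nonneg _ _, clamp_le hT _⟩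
      have h := hM _ hmem p.2
      have hw : wt T (clamp T p.1) p.2 = wt T p.1 p.2 := by simp only [wt, clamp_of_mem hmem]
      rw [hw] at h
      rw [norm_mul, norm_inv, Complex.norm_real, Real.norm_of_nonneg (wt_pos T _ _).le,
        inv_mul_le_iff₀ (wt_pos T _ _)]
      linarith)

theorem ofBound_apply (hT : 0 ≤ T) (f : ℝ → ℝ → ℂ) (hf) (M : ℝ) (hM) (p : ℝ × ℝ) :
    ofBound T hT f hf M hM p = ((wt T p.1 p.2 : ℝ) : ℂ)⁻¹ * f (clamp T p.1) p.2 := rfl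

theorem norm_ofBound_le (hT : 0 ≤ T) (f : ℝ → ℝ → ℂ) (hf) {M : ℝ} (hM) (h0 : 0 ≤ M) :
    ‖ofBound T hT f hf M hM‖ ≤ M :=
  BoundedContinuousFunction.norm_ofNormedAddCommGroup_le _ h0 _

theorem coef_ofBound (hT : 0 ≤ T) (f : ℝ → ℝ → ℂ) (hf) (M : ℝ) (hM) {t : ℝ} (ht : t ∈ Icc 0 T)
    (ξ : ℝ) : coef T (ofBound T hT f hf M hM) t ξ = f t ξ := by
  have : (wt T t ξ : ℂ) ≠ 0 := by exact_mod_cast (wt_pos T t ξ).ne'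
  rw [coef, ofBound_apply, clamp_of_mem ht]
  field_simp

/-- A Hermitian function dominated by the weight gives an element of `realAmp`. -/
noncomputable def realOfBound (T : ℝ) (hT : 0 ≤ T) (f : ℝ → ℝ → ℂ)
    (hf : Continuous fun p : ℝ × ℝ => f p.1 p.2)
    (M : ℝ) (hM : ∀ t ∈ Icc 0 T, ∀ ξ, ‖f t ξ‖ ≤ M * wt T t ξ)
    (hc : ∀ t ξ, f t (-ξ) = conj (f t ξ)) : realAmp :=
  ⟨ofBound T hT f hf M hM, fun t ξ => by simp [ofBound_apply, hc, wt_neg]⟩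

/-- The Duhamel integral as an element of `realAmp`. -/
noncomputable def duhamelAmp (hT : 0 ≤ T) (c : ℝ) (A B : realAmp) : realAmp :=
  realOfBound T hT (duhamel T c A B) (continuous_duhamel hT c A B)
    (8 * Real.pi ^ 2 * (‖A‖ * ‖B‖)) (fun _ ht ξ => norm_duhamel_le hT c A B ht ξ)
    (duhamel_neg c A B)

theorem norm_duhamelAmp_le (hT : 0 ≤ T) (c : ℝ) (A B : realAmp) :
    ‖duhamelAmp hT c A B‖ ≤ 8 * Real.pi ^ 2 * ‖A‖ * ‖B‖ :=
  (norm_ofBound_le hT (duhamel T c A B) (continuous_duhamel hT c A B)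
    (M := 8 * Real.pi ^ 2 * (‖A‖ * ‖B‖)) (fun _ ht ξ => norm_duhamel_le hT c A B ht ξ)
    (by positivity)).trans_eq (by ring)

theorem coef_duhamelAmp (hT : 0 ≤ T) (c : ℝ) (A B : realAmp) {t : ℝ} (ht : t ∈ Icc 0 T) (ξ : ℝ) :
    coef T (duhamelAmp hT c A B) t ξ = duhamel T c A B t ξ :=
  coef_ofBound hT _ (continuous_duhamel hT c A B) (8 * Real.pi ^ 2 * (‖A‖ * ‖B‖))
    (fun _ ht ξ => norm_duhamel_le hT c A B ht ξ) ht ξ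

/-! ### Bilinearity of the Duhamel term -/

theorem coef_add (A B : Amp) (t ξ : ℝ) : coef T (A + B) t ξ = coef T A t ξ + coef T B t ξ := by
  simp [coef, mul_add]

theorem coef_smul (r : ℝ) (A : Amp) (t ξ : ℝ) : coef T (r • A) t ξ = r * coef T A t ξ := by
  simp [coef]; ring

theorem conv_add_left (hT : 0 ≤ T) (A A' B : Amp) (t ξ : ℝ) :
    conv T (A + A') B t ξ = conv T A B t ξ + conv T A' B t ξ := by
  rw [conv, conv, conv, ← integral_add (integrable_coef_mul_coef hT A B t ξ)
    (integrable_coef_mul_coef hT A' B t ξ)]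
  simp only [coef_add, add_mul]

theorem conv_add_right (hT : 0 ≤ T) (A B B' : Amp) (t ξ : ℝ) :
    conv T A (B + B') t ξ = conv T A B t ξ + conv T A B' t ξ := by
  rw [conv, conv, conv, ← integral_add (integrable_coef_mul_coef hT A B t ξ)
    (integrable_coef_mul_coef hT A B' t ξ)]
  simp only [coef_add, mul_add]

theorem conv_smul_left (r : ℝ) (A B : Amp) (t ξ : ℝ) :
    conv T (r • A) B t ξ = r * conv T A B t ξ := by
  rw [conv, conv, ← integral_const_mul]
  simp only [coef_smul, mul_assoc]

theorem conv_smul_right (r : ℝ) (A B : Amp) (t ξ : ℝ) :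
    conv T A (r • B) t ξ = r * conv T A B t ξ := by
  rw [conv, conv, ← integral_const_mul]
  simp only [coef_smul, mul_left_comm]

theorem intervalIntegrable_duhamel (hT : 0 ≤ T) (c : ℝ) (A B : Amp) (t ξ a b : ℝ) :
    IntervalIntegrable (fun τ => airy c (t - τ) ξ * src T A B τ ξ) volume a b := by
  have h1 := (continuous_airy c).comp (by fun_prop : Continuous fun τ : ℝ => (t - τ, ξ))
  have h2 := (continuous_src hT A B).comp (by fun_prop : Continuous fun τ : ℝ => (τ, ξ))
  exact (h1.mul h2).intervalIntegrable _ _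

theorem duhamel_add_left (hT : 0 ≤ T) (c : ℝ) (A A' B : Amp) (t ξ : ℝ) :
    duhamel T c (A + A') B t ξ = duhamel T c A B t ξ + duhamel T c A' B t ξ := by
  rw [duhamel, duhamel, duhamel, ← intervalIntegral.integral_add
    (intervalIntegrable_duhamel hT c A B t ξ _ _) (intervalIntegrable_duhamel hT c A' B t ξ _ _)]
  simp only [src, conv_add_left hT, mul_add]

theorem duhamel_add_right (hT : 0 ≤ T) (c : ℝ) (A B B' : Amp) (t ξ : ℝ) :
    duhamel T c A (B + B') t ξ = duhamel T c A B t ξ + duhamel T c A B' t ξ := by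
  rw [duhamel, duhamel, duhamel, ← intervalIntegral.integral_add
    (intervalIntegrable_duhamel hT c A B t ξ _ _) (intervalIntegrable_duhamel hT c A B' t ξ _ _)]
  simp only [src, conv_add_right hT, mul_add]

theorem duhamel_smul_left (c r : ℝ) (A B : Amp) (t ξ : ℝ) :
    duhamel T c (r • A) B t ξ = r * duhamel T c A B t ξ := by
  rw [duhamel, duhamel, ← intervalIntegral.integral_const_mul]
  refine intervalIntegral.integral_congr fun τ _ => ?_
  simp only [src, conv_smul_left]; ring

theorem duhamel_smul_right (c r : ℝ) (A B : Amp) (t ξ : ℝ) :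
    duhamel T c A (r • B) t ξ = r * duhamel T c A B t ξ := by
  rw [duhamel, duhamel, ← intervalIntegral.integral_const_mul]
  refine intervalIntegral.integral_congr fun τ _ => ?_
  simp only [src, conv_smul_right]; ring

theorem duhamelAmp_apply (hT : 0 ≤ T) (c : ℝ) (A B : realAmp) (p : ℝ × ℝ) :
    (duhamelAmp hT c A B : Amp) p
      = ((wt T p.1 p.2 : ℝ) : ℂ)⁻¹ * duhamel T c A B (clamp T p.1) p.2 := rfl

theorem duhamelAmp_add_left (hT : 0 ≤ T) (c : ℝ) (A A' B : realAmp) :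
    duhamelAmp hT c (A + A') B = duhamelAmp hT c A B + duhamelAmp hT c A' B := by
  refine Subtype.ext (DFunLike.ext _ _ fun p => ?_)
  rw [Submodule.coe_add, BoundedContinuousFunction.add_apply]
  simp only [duhamelAmp_apply, Submodule.coe_add, duhamel_add_left hT, mul_add]

theorem duhamelAmp_add_right (hT : 0 ≤ T) (c : ℝ) (A B B' : realAmp) :
    duhamelAmp hT c A (B + B') = duhamelAmp hT c A B + duhamelAmp hT c A B' := by
  refine Subtype.ext (DFunLike.ext _ _ fun p => ?_)
  rw [Submodule.coe_add, BoundedContinuousFunction.add_apply]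
  simp only [duhamelAmp_apply, Submodule.coe_add, duhamel_add_right hT, mul_add]

theorem duhamelAmp_smul_left (hT : 0 ≤ T) (c r : ℝ) (A B : realAmp) :
    duhamelAmp hT c (r • A) B = r • duhamelAmp hT c A B := by
  refine Subtype.ext (DFunLike.ext _ _ fun p => ?_)
  rw [Submodule.coe_smul, BoundedContinuousFunction.smul_apply]
  simp only [duhamelAmp_apply, Submodule.coe_smul, duhamel_smul_left, Complex.real_smul]
  ring

theorem duhamelAmp_smul_right (hT : 0 ≤ T) (c r : ℝ) (A B : realAmp) :
    duhamelAmp hT c A (r • B) = r • duhamelAmp hT c A B := by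
  refine Subtype.ext (DFunLike.ext _ _ fun p => ?_)
  rw [Submodule.coe_smul, BoundedContinuousFunction.smul_apply]
  simp only [duhamelAmp_apply, Submodule.coe_smul, duhamel_smul_right, Complex.real_smul]
  ring

end

/-! ### Exponentially decaying Fourier transforms and Sobolev spaces -/

section

theorem exists_rpow_mul_exp_le (σ : ℝ) :
    ∃ C : ℝ, 0 ≤ C ∧ ∀ ξ : ℝ, (1 + ξ ^ 2) ^ σ * Real.exp (-|ξ|) ≤ C * (1 + ξ ^ 2)⁻¹ := by
  obtain ⟨m, hm⟩ := exists_nat_ge σ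
  -- The constant comes from one term of the exponential series at `1 + |ξ|`; the extra power in `m
  -- + 1` supplies the decay `(1 + ξ²)⁻¹`.
  refine ⟨Real.exp 1 * (2 * (m + 1)).factorial, by positivity, fun ξ => ?_⟩
  have h1 : 1 ≤ 1 + ξ ^ 2 := by nlinarith [sq_nonneg ξ]
  have h2 : (1 + ξ ^ 2) ^ σ ≤ (1 + ξ ^ 2) ^ m := by
    rw [← Real.rpow_natCast _ m]; exact Real.rpow_le_rpow_of_exponent_le h1 hm
  have h3 : (1 + ξ ^ 2) ^ (m + 1) ≤ (1 + |ξ|) ^ (2 * (m + 1)) := by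
    rw [pow_mul]
    exact pow_le_pow_left₀ (by positivity) (by nlinarith [sq_abs ξ, abs_nonneg ξ]) _
  have h4 : (1 + |ξ|) ^ (2 * (m + 1)) ≤ Real.exp (1 + |ξ|) * (2 * (m + 1)).factorial := by
    have := Real.pow_div_factorial_le_exp (1 + |ξ|) (by positivity) (2 * (m + 1))
    rwa [div_le_iff₀ (by positivity)] at this
  rw [← div_eq_mul_inv, le_div_iff₀ (by positivity)]
  calc (1 + ξ ^ 2) ^ σ * Real.exp (-|ξ|) * (1 + ξ ^ 2)
      ≤ (1 + ξ ^ 2) ^ m * Real.exp (-|ξ|) * (1 + ξ ^ 2) := by gcongr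
    _ = (1 + ξ ^ 2) ^ (m + 1) * Real.exp (-|ξ|) := by ring
    _ ≤ (Real.exp (1 + |ξ|) * (2 * (m + 1)).factorial) * Real.exp (-|ξ|) := by
        gcongr; exact h3.trans h4
    _ = Real.exp 1 * (2 * (m + 1)).factorial := by
        rw [mul_right_comm, ← Real.exp_add]; congr 2; ring

theorem continuous_one_add_sq_rpow (σ : ℝ) : Continuous fun ξ : ℝ => (1 + ξ ^ 2) ^ σ :=
  Continuous.rpow_const (by fun_prop) fun ξ => Or.inl (by positivity)

theorem integrable_rpow_mul_exp (σ : ℝ) :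
    Integrable fun ξ : ℝ => (1 + ξ ^ 2) ^ σ * Real.exp (-|ξ|) := by
  obtain ⟨C, _, hC⟩ := exists_rpow_mul_exp_le σ
  refine Integrable.mono' (integrable_inv_one_add_sq.const_mul C)
    (Continuous.aestronglyMeasurable ?_) (Filter.Eventually.of_forall fun ξ => ?_)
  · have := continuous_one_add_sq_rpow σ
    fun_prop
  · rw [Real.norm_of_nonneg (by positivity)]; exact hC ξ

theorem abs_pow_le_rpow (n : ℕ) (ξ : ℝ) : |ξ| ^ n ≤ (1 + ξ ^ 2) ^ (n : ℝ) := by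
  rw [Real.rpow_natCast]
  exact pow_le_pow_left₀ (abs_nonneg _) (by nlinarith [sq_abs ξ, sq_nonneg (|ξ| - 1)]) _

theorem integrable_abs_pow_mul_exp (n : ℕ) :
    Integrable fun ξ : ℝ => |ξ| ^ n * Real.exp (-|ξ|) := by
  refine Integrable.mono' (integrable_rpow_mul_exp n)
    (Continuous.aestronglyMeasurable (by fun_prop)) (Filter.Eventually.of_forall fun ξ => ?_)
  rw [Real.norm_of_nonneg (by positivity)]
  exact mul_le_mul_of_nonneg_right (abs_pow_le_rpow n ξ) (Real.exp_pos _).le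

/-- Continuity together with domination by a multiple of `exp (-|ξ|)`. -/
def ExpDecay (g : ℝ → ℂ) : Prop :=
  Continuous g ∧ ∃ M : ℝ, ∀ ξ, ‖g ξ‖ ≤ M * Real.exp (-|ξ|)

namespace ExpDecay

variable {g h : ℝ → ℂ}

theorem integrable_pow_mul (hg : ExpDecay g) (n : ℕ) : Integrable fun ξ : ℝ => (ξ : ℂ) ^ n * g ξ := by
  obtain ⟨hc, M, hM⟩ := hg
  refine Integrable.mono' ((integrable_abs_pow_mul_exp n).const_mul M)
    (Continuous.aestronglyMeasurable (by fun_prop)) (Filter.Eventually.of_forall fun ξ => ?_)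
  rw [norm_mul, norm_pow, Complex.norm_real, Real.norm_eq_abs]
  calc |ξ| ^ n * ‖g ξ‖ ≤ |ξ| ^ n * (M * Real.exp (-|ξ|)) := by gcongr; exact hM ξ
    _ = _ := by ring

theorem integrable (hg : ExpDecay g) : Integrable g := by simpa using hg.integrable_pow_mul 0

theorem integrable_weight (hg : ExpDecay g) (σ : ℝ) :
    Integrable fun ξ : ℝ => (1 + ξ ^ 2) ^ σ * ‖g ξ‖ ^ 2 := by
  obtain ⟨hc, M, hM⟩ := hg
  have h1 := continuous_one_add_sq_rpow σ
  refine Integrable.mono' ((integrable_rpow_mul_exp σ).const_mul (M ^ 2))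
    (Continuous.aestronglyMeasurable (by fun_prop)) (Filter.Eventually.of_forall fun ξ => ?_)
  rw [Real.norm_of_nonneg (by positivity)]
  have h2 : ‖g ξ‖ ^ 2 ≤ M ^ 2 * Real.exp (-|ξ|) := by
    calc ‖g ξ‖ ^ 2 ≤ (M * Real.exp (-|ξ|)) ^ 2 := pow_le_pow_left₀ (norm_nonneg _) (hM ξ) 2
      _ = M ^ 2 * (Real.exp (-|ξ|) * Real.exp (-|ξ|)) := by ring
      _ ≤ M ^ 2 * (Real.exp (-|ξ|) * 1) := by
        gcongr; exact Real.exp_le_one_iff.mpr (by simp)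
      _ = _ := by ring
  calc (1 + ξ ^ 2) ^ σ * ‖g ξ‖ ^ 2 ≤ (1 + ξ ^ 2) ^ σ * (M ^ 2 * Real.exp (-|ξ|)) := by gcongr
    _ = _ := by ring

end ExpDecay

/-- Multiplication by `(1 + ξ²)^(σ/2)`. -/
noncomputable def weighted (σ : ℝ) (g : ℝ → ℂ) (ξ : ℝ) : ℂ :=
  (((1 + ‖ξ‖ ^ 2) ^ (σ / 2) : ℝ) : ℂ) * g ξ

theorem norm_weighted_sq (σ : ℝ) (g : ℝ → ℂ) (ξ : ℝ) :
    ‖weighted σ g ξ‖ ^ 2 = (1 + ξ ^ 2) ^ σ * ‖g ξ‖ ^ 2 := by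
  rw [weighted, norm_mul, mul_pow, Complex.norm_real, Real.norm_of_nonneg (by positivity),
    ← Real.rpow_natCast, ← Real.rpow_mul (by positivity), Real.norm_eq_abs, sq_abs]
  norm_num

theorem ExpDecay.memLp_weighted {g : ℝ → ℂ} (hg : ExpDecay g) (σ : ℝ) :
    MemLp (weighted σ g) 2 := by
  rw [memLp_two_iff_integrable_sq_norm]
  · simpa only [norm_weighted_sq] using hg.integrable_weight σ
  · have h1 := continuous_one_add_sq_rpow (σ / 2)
    have h2 := hg.1
    refine Continuous.aestronglyMeasurable ?_
    unfold weighted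
    simp only [Real.norm_eq_abs, sq_abs]
    fun_prop

theorem weighted_zero (g : ℝ → ℂ) : weighted 0 g = g := by
  ext ξ; simp [weighted]

theorem ExpDecay.memLp {g : ℝ → ℂ} (hg : ExpDecay g) : MemLp g 2 := by
  simpa only [weighted_zero] using hg.memLp_weighted 0

theorem continuous_fourierInv {g : ℝ → ℂ} (hg : Integrable g) : Continuous (𝓕⁻ g) :=
  VectorFourier.fourierIntegral_continuous Real.continuous_fourierChar
    (continuous_inner (𝕜 := ℝ) (E := ℝ)).neg hg

theorem integral_mul_fourierInv (φ : 𝓢(ℝ, ℂ)) {g : ℝ → ℂ} (hg : Integrable g) :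
    ∫ x, φ x • 𝓕⁻ g x = ∫ ξ, 𝓕⁻ φ ξ • g ξ := by
  have h := VectorFourier.integral_fourierIntegral_smul_eq_flip (e := Real.fourierChar)
    (μ := volume) (ν := volume) (L := -innerₗ ℝ) (f := (φ : ℝ → ℂ)) (g := g)
    Real.continuous_fourierChar (continuous_inner (𝕜 := ℝ) (E := ℝ)).neg
    φ.integrable hg
  have hflip : (-innerₗ ℝ : ℝ →ₗ[ℝ] ℝ →ₗ[ℝ] ℝ).flip = -innerₗ ℝ := by
    ext; simp
  rw [hflip] at h
  rw [SchwartzMap.fourierInv_coe]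
  exact h.symm

/-- Both sides pair identically with compactly supported smooth functions, by self-adjointness of
the transform; so the abstract `L²` inverse transform is the concrete integral. -/
theorem fourierInv_toLp_ae {g : ℝ → ℂ} (hg : ExpDecay g) :
    (𝓕⁻ (hg.memLp.toLp g) : Lp ℂ 2 (volume : Measure ℝ)) =ᵐ[volume] 𝓕⁻ g := by
  refine ae_eq_of_integral_contDiff_smul_eq
    ((Lp.memLp _).locallyIntegrable (by norm_num))
    (continuous_fourierInv hg.integrable).locallyIntegrable fun φ hφ hc => ?_
  have hg₁ : HasCompactSupport (Complex.ofRealCLM ∘ φ) := hc.comp_left rfl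
  have hg₂ : ContDiff ℝ ∞ (Complex.ofRealCLM ∘ φ) := by fun_prop
  have h1 := integral_mul_fourierInv (hg₁.toSchwartzMap hg₂) hg.integrable
  have h2 : (Lp.toTemperedDistribution (𝓕⁻ (hg.memLp.toLp g) : Lp ℂ 2 (volume : Measure ℝ)))
      (hg₁.toSchwartzMap hg₂) = ∫ ξ, 𝓕⁻ (hg₁.toSchwartzMap hg₂) ξ • g ξ := by
    rw [← Lp.fourierInv_toTemperedDistribution_eq, TemperedDistribution.fourierInv_apply,
      Lp.toTemperedDistribution_apply]
    refine integral_congr_ae ?_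
    filter_upwards [hg.memLp.coeFn_toLp] with ξ hξ
    rw [hξ]
  rw [← h1, Lp.toTemperedDistribution_apply] at h2
  simpa using h2

theorem memLp_fourierInv {g : ℝ → ℂ} (hg : ExpDecay g) : MemLp (𝓕⁻ g) 2 :=
  (memLp_congr_ae (fourierInv_toLp_ae hg)).mp (Lp.memLp _)

theorem toLp_fourierInv {g : ℝ → ℂ} (hg : ExpDecay g) :
    (memLp_fourierInv hg).toLp (𝓕⁻ g) = 𝓕⁻ (hg.memLp.toLp g) := by
  refine Lp.ext ?_
  exact (memLp_fourierInv hg).coeFn_toLp.trans (fourierInv_toLp_ae hg).symm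

theorem toLp_fourierInv_add {g h : ℝ → ℂ} (hg : ExpDecay g) (hh : ExpDecay h)
    (hgh : ExpDecay (g + h)) : (memLp_fourierInv hgh).toLp (𝓕⁻ (g + h))
      = (memLp_fourierInv hg).toLp (𝓕⁻ g) + (memLp_fourierInv hh).toLp (𝓕⁻ h) := by
  rw [toLp_fourierInv hg, toLp_fourierInv hh, toLp_fourierInv hgh,
    ← FourierTransform.fourierInv_add]
  rfl

theorem toLp_fourierInv_smul (c : ℝ) {g : ℝ → ℂ} (hg : ExpDecay g) (hcg : ExpDecay (c • g)) :
    (memLp_fourierInv hcg).toLp (𝓕⁻ (c • g)) = c • (memLp_fourierInv hg).toLp (𝓕⁻ g) := by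
  have h : hcg.memLp.toLp (c • g) = (c : ℂ) • hg.memLp.toLp g := by
    rw [← MemLp.toLp_const_smul]; rfl
  rw [toLp_fourierInv hg, toLp_fourierInv hcg, h, FourierTransform.fourierInv_smul]
  rfl

theorem hasTemperateGrowth_weight (σ : ℝ) :
    (fun x : ℝ => (((1 + ‖x‖ ^ 2) ^ (σ / 2) : ℝ) : ℂ)).HasTemperateGrowth := by fun_prop

theorem smulLeftCLM_toLp {g : ℝ → ℂ} (hg : ExpDecay g) (σ : ℝ) :
    TemperedDistribution.smulLeftCLM ℂ (fun x : ℝ => (((1 + ‖x‖ ^ 2) ^ (σ / 2) : ℝ) : ℂ))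
      (Lp.toTemperedDistribution (hg.memLp.toLp g))
    = Lp.toTemperedDistribution ((hg.memLp_weighted σ).toLp (weighted σ g)) := by
  ext φ
  rw [TemperedDistribution.smulLeftCLM_apply_apply, Lp.toTemperedDistribution_apply,
    Lp.toTemperedDistribution_apply]
  refine integral_congr_ae ?_
  filter_upwards [hg.memLp.coeFn_toLp, (hg.memLp_weighted σ).coeFn_toLp] with ξ h1 h2
  rw [h1, h2, SchwartzMap.smulLeftCLM_apply_apply (hasTemperateGrowth_weight σ), weighted]
  simp only [smul_eq_mul]; ring

/-- The Bessel potential multiplies the Fourier transform by the weight. This gives membership in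
`H^σ` and, with Plancherel, the norm formula `norm_ofFourier_sq`. -/
theorem besselPotential_fourierInv {g : ℝ → ℂ} (hg : ExpDecay g) (σ : ℝ) :
    TemperedDistribution.besselPotential ℝ ℂ σ
      (Lp.toTemperedDistributionCLM ℂ volume 2 ((memLp_fourierInv hg).toLp (𝓕⁻ g)))
    = Lp.toTemperedDistributionCLM ℂ volume 2 (𝓕⁻ ((hg.memLp_weighted σ).toLp (weighted σ g))) := by
  rw [toLp_fourierInv hg, Lp.toTemperedDistributionCLM_apply, Lp.toTemperedDistributionCLM_apply,
    ← Lp.fourierInv_toTemperedDistribution_eq, ← Lp.fourierInv_toTemperedDistribution_eq,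
    TemperedDistribution.besselPotential, TemperedDistribution.fourierMultiplierCLM_apply,
    FourierTransform.fourier_fourierInv_eq, smulLeftCLM_toLp hg]

/-- The admissible Fourier transforms of real-valued functions. -/
def fourierData : Submodule ℝ (ℝ → ℂ) where
  carrier := {g | ExpDecay g ∧ ∀ ξ, g (-ξ) = conj (g ξ)}
  zero_mem' := ⟨⟨continuous_const, 0, fun ξ => by simp⟩, fun ξ => by simp⟩
  add_mem' := by
    rintro f g ⟨⟨hf, M, hM⟩, hf'⟩ ⟨⟨hg, N, hN⟩, hg'⟩
    refine ⟨⟨hf.add hg, M + N, fun ξ => ?_⟩, fun ξ => by simp [hf' ξ, hg' ξ]⟩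
    rw [add_mul]
    exact (norm_add_le _ _).trans (add_le_add (hM ξ) (hN ξ))
  smul_mem' := by
    rintro c f ⟨⟨hf, M, hM⟩, hf'⟩
    refine ⟨⟨hf.const_smul c, |c| * M, fun ξ => ?_⟩, fun ξ => by simp [hf' ξ]⟩
    rw [Pi.smul_apply, norm_smul, Real.norm_eq_abs, mul_assoc]
    exact mul_le_mul_of_nonneg_left (hM ξ) (abs_nonneg _)

theorem conj_fourierInv {g : ℝ → ℂ} (hg : ∀ ξ, g (-ξ) = conj (g ξ)) (x : ℝ) :
    conj (𝓕⁻ g x) = 𝓕⁻ g x := by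
  rw [Real.fourierInv_eq', ← integral_conj, ← integral_neg_eq_self]
  refine integral_congr_ae (Filter.Eventually.of_forall fun ξ => ?_)
  simp only [smul_eq_mul, map_mul, hg, ← Complex.exp_conj, Complex.conj_conj]
  simp [Complex.conj_ofNat]

/-- Hermitian symmetry makes the function real, and every real subalgebra of `ℂ` contains the reals.
-/
theorem isValuedIn_fourierInv (𝔽 : Subalgebra ℝ ℂ) {g : ℝ → ℂ} (hg : ExpDecay g)
    (hg' : ∀ ξ, g (-ξ) = conj (g ξ)) :
    IsValuedIn 𝔽
      (Lp.toTemperedDistributionCLM ℂ volume 2 ((memLp_fourierInv hg).toLp (𝓕⁻ g))) := by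
  intro φ hφ
  rw [Lp.toTemperedDistributionCLM_apply, Lp.toTemperedDistribution_apply]
  have h : conj (∫ x, φ x • (memLp_fourierInv hg).toLp (𝓕⁻ g) x)
      = ∫ x, φ x • (memLp_fourierInv hg).toLp (𝓕⁻ g) x := by
    rw [← integral_conj]
    refine integral_congr_ae ?_
    filter_upwards [(memLp_fourierInv hg).coeFn_toLp] with x hx
    rw [hx, smul_eq_mul, map_mul, conj_fourierInv hg', Complex.conj_eq_iff_im.mpr (hφ x)]
  obtain ⟨r, hr⟩ := Complex.conj_eq_iff_real.mp h
  rw [hr]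
  exact 𝔽.algebraMap_mem r

variable {𝔽 : Subalgebra ℝ ℂ} {σ : ℝ}

/-- The element of `H^σ` with a given admissible Fourier transform. -/
noncomputable def ofFourier (𝔽 : Subalgebra ℝ ℂ) (σ : ℝ) : fourierData →ₗ[ℝ] SobolevSpace 𝔽 σ where
  toFun g := (⟨Lp.toTemperedDistributionCLM ℂ volume 2 ((memLp_fourierInv g.2.1).toLp (𝓕⁻ (g : ℝ → ℂ))),
    ⟨_, besselPotential_fourierInv g.2.1 σ⟩, isValuedIn_fourierInv 𝔽 g.2.1 g.2.2⟩ :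
      sobolevSubmodule 𝔽 σ)
  map_add' g h := Subtype.ext <|
    (congrArg (Lp.toTemperedDistributionCLM ℂ volume 2)
      (toLp_fourierInv_add g.2.1 h.2.1 (g + h).2.1)).trans (map_add _ _ _)
  map_smul' c g := Subtype.ext <|
    (congrArg (Lp.toTemperedDistributionCLM ℂ volume 2)
      (toLp_fourierInv_smul c g.2.1 (c • g).2.1)).trans
      (ContinuousLinearMap.map_smul_of_tower _ _ _)

theorem ofFourier_toDistribution (g : fourierData) : (ofFourier 𝔽 σ g).toDistribution
    = Lp.toTemperedDistributionCLM ℂ volume 2 ((memLp_fourierInv g.2.1).toLp (𝓕⁻ (g : ℝ → ℂ))) := rfl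

theorem isGivenBy_ofFourier (g : fourierData) : (ofFourier 𝔽 σ g).IsGivenBy (𝓕⁻ (g : ℝ → ℂ)) :=
  ⟨memLp_fourierInv g.2.1, rfl⟩

theorem norm_ofFourier_sq (g : fourierData) :
    ‖ofFourier 𝔽 σ g‖ ^ 2 = ∫ ξ, (1 + ξ ^ 2) ^ σ * ‖(g : ℝ → ℂ) ξ‖ ^ 2 := by
  have h1 : SobolevSpace.bessel (ofFourier 𝔽 σ g)
      = 𝓕⁻ ((g.2.1.memLp_weighted σ).toLp (weighted σ g)) := by
    apply SobolevSpace.toTempered_injective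
    rw [← SobolevSpace.bessel_spec, ofFourier_toDistribution]
    exact besselPotential_fourierInv g.2.1 σ
  have h2 : ‖ofFourier 𝔽 σ g‖ = ‖(g.2.1.memLp_weighted σ).toLp (weighted σ g)‖ := by
    change ‖SobolevSpace.bessel (ofFourier 𝔽 σ g)‖ = _
    rw [h1]
    exact (Lp.fourierTransformₗᵢ ℝ ℂ).symm.norm_map _
  rw [h2, Lp.norm_toLp, ← integral_congr_ae (Filter.Eventually.of_forall (norm_weighted_sq σ g)),
    (g.2.1.memLp_weighted σ).eLpNorm_eq_integral_rpow_norm (by norm_num) (by norm_num),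
    ENNReal.toReal_ofReal (by positivity), ← Real.rpow_natCast, ← Real.rpow_mul (by positivity)]
  norm_num

end

/-! ### From the integral equation to the differential equation -/

section

theorem ExpDecay.comp_neg {g : ℝ → ℂ} (hg : ExpDecay g) : ExpDecay fun ξ => g (-ξ) := by
  obtain ⟨hc, M, hM⟩ := hg
  exact ⟨by fun_prop, M, fun ξ => by simpa using hM (-ξ)⟩

theorem ExpDecay.integrable_pow_smul {g : ℝ → ℂ} (hg : ExpDecay g) (n : ℕ) :
    Integrable fun ξ : ℝ => ξ ^ n • g ξ := by
  refine (hg.integrable_pow_mul n).congr (Filter.Eventually.of_forall fun ξ => ?_)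
  simp

theorem contDiff_fourierInv {g : ℝ → ℂ} (hg : ExpDecay g) : ContDiff ℝ ∞ (𝓕⁻ g) := by
  rw [Real.fourierInv_eq_fourier_comp_neg]
  refine Real.contDiff_fourier fun n _ => ?_
  convert! (hg.comp_neg.integrable_pow_smul n).norm with ξ
  simp

theorem iteratedDeriv_fourierInv {g : ℝ → ℂ} (hg : ExpDecay g) (n : ℕ) :
    iteratedDeriv n (𝓕⁻ g) = 𝓕⁻ fun ξ : ℝ => (2 * Real.pi * Complex.I * ξ) ^ n * g ξ := by
  rw [Real.fourierInv_eq_fourier_comp_neg, Real.fourierInv_eq_fourier_comp_neg,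
    Real.iteratedDeriv_fourier (N := ⊤) (fun n _ => hg.comp_neg.integrable_pow_smul n) le_top]
  congr 1
  ext ξ
  simp

variable {T : ℝ}

theorem continuous_coef_right (A : Amp) (t : ℝ) : Continuous (coef T A t) :=
  (continuous_coef A).comp (by fun_prop : Continuous fun ξ : ℝ => (t, ξ))

theorem norm_coef_le_exp (hT : 0 ≤ T) (A : Amp) (t ξ : ℝ) :
    ‖coef T A t ξ‖ ≤ ‖A‖ * Real.exp (-|ξ|) :=
  (norm_coef_le A t ξ).trans (mul_le_mul_of_nonneg_left (wt_le_exp hT t ξ) (norm_nonneg _))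

theorem expDecay_coef (hT : 0 ≤ T) (A : Amp) (t : ℝ) : ExpDecay (coef T A t) :=
  ⟨continuous_coef_right A t, ‖A‖, norm_coef_le_exp hT A t⟩

theorem expDecay_conv (hT : 0 ≤ T) (A B : Amp) (t : ℝ) : ExpDecay (conv T A B t) := by
  have h := (continuous_conv hT A B).comp (by fun_prop : Continuous fun ξ : ℝ => (t, ξ))
  refine ⟨h, 4 * Real.pi * (‖A‖ * ‖B‖), fun ξ => (norm_conv_le hT A B t ξ).trans ?_⟩
  exact mul_le_mul_of_nonneg_left (wt_le_exp hT t ξ) (by positivity)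

theorem fourierInv_conv (hT : 0 ≤ T) (A B : Amp) (t x : ℝ) :
    𝓕⁻ (conv T A B t) x = 𝓕⁻ (coef T A t) x * 𝓕⁻ (coef T B t) x := by
  rw [Real.fourierInv_eq_fourier_neg, Real.fourierInv_eq_fourier_neg,
    Real.fourierInv_eq_fourier_neg, ← Real.fourier_mul_convolution_eq
      (expDecay_coef hT A t).integrable (expDecay_coef hT B t).integrable]
  rfl

/-- The frequency side of the solution of a forced Airy equation. -/
noncomputable def forced (T c r : ℝ) (g : ℝ → ℂ) (A B : Amp) (t ξ : ℝ) : ℂ :=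
  airy c t ξ * g ξ + r * duhamel T c A B t ξ

/-- The group law removes `t` from the integrand, leaving the product rule and the fundamental
theorem of calculus for the time derivative. -/
theorem duhamel_eq (c : ℝ) (A B : Amp) (t ξ : ℝ) : duhamel T c A B t ξ
    = airy c t ξ * ∫ τ in (0 : ℝ)..t, airy c (-τ) ξ * src T A B τ ξ := by
  rw [duhamel, ← intervalIntegral.integral_const_mul]
  refine intervalIntegral.integral_congr fun τ _ => ?_
  simp only [sub_eq_add_neg, airy_add, mul_assoc]

theorem hasDerivAt_duhamel (hT : 0 ≤ T) (c : ℝ) (A B : Amp) (t ξ : ℝ) :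
    HasDerivAt (fun t => duhamel T c A B t ξ)
      (c * cube ξ * Complex.I * duhamel T c A B t ξ + src T A B t ξ) t := by
  simp only [duhamel_eq]
  have hcont : Continuous fun τ : ℝ => airy c (-τ) ξ * src T A B τ ξ := by
    have h1 := (continuous_airy c).comp (by fun_prop : Continuous fun τ : ℝ => (-τ, ξ))
    have h2 := (continuous_src hT A B).comp (by fun_prop : Continuous fun τ : ℝ => (τ, ξ))
    exact h1.mul h2
  convert! (hasDerivAt_airy c t ξ).mul (hcont.integral_hasStrictDerivAt 0 t).hasDerivAt using 1
  have : airy c t ξ * airy c (-t) ξ = 1 := by rw [← airy_add, add_neg_cancel, airy_zero]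
  linear_combination (-src T A B t ξ) * this

theorem hasDerivAt_forced (hT : 0 ≤ T) (c r : ℝ) (g : ℝ → ℂ) (A B : Amp) (t ξ : ℝ) :
    HasDerivAt (fun t => forced T c r g A B t ξ)
      (c * cube ξ * Complex.I * forced T c r g A B t ξ + r * src T A B t ξ) t := by
  convert! ((hasDerivAt_airy c t ξ).mul_const (g ξ)).add
    ((hasDerivAt_duhamel hT c A B t ξ).const_mul (r : ℂ)) using 1
  rw [forced]; ring

theorem norm_src_le_exp (hT : 0 ≤ T) (A B : Amp) (t ξ : ℝ) :
    ‖src T A B t ξ‖ ≤ 8 * Real.pi ^ 2 * (‖A‖ * ‖B‖) * (|ξ| * Real.exp (-|ξ|)) :=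
  (norm_src_le hT A B t ξ).trans (mul_le_mul_of_nonneg_left
    (mul_le_mul_of_nonneg_left (wt_le_exp hT t ξ) (abs_nonneg ξ)) (by positivity))

theorem norm_duhamel_le_exp (hT : 0 ≤ T) (c : ℝ) (A B : Amp) (t ξ : ℝ) :
    ‖duhamel T c A B t ξ‖ ≤ 8 * Real.pi ^ 2 * (‖A‖ * ‖B‖) * (|ξ| * Real.exp (-|ξ|)) * |t| := by
  have h := intervalIntegral.norm_integral_le_of_norm_le_const (a := 0) (b := t)
    (f := fun τ => airy c (t - τ) ξ * src T A B τ ξ)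
    (C := 8 * Real.pi ^ 2 * (‖A‖ * ‖B‖) * (|ξ| * Real.exp (-|ξ|))) fun τ _ => by
      rw [norm_mul, norm_airy, one_mul]; exact norm_src_le_exp hT A B τ ξ
  rwa [sub_zero] at h

theorem continuous_forced (hT : 0 ≤ T) (c r : ℝ) {g : ℝ → ℂ} (hg : Continuous g) (A B : Amp)
    (t : ℝ) : Continuous (forced T c r g A B t) := by
  have h1 := (continuous_airy c).comp (by fun_prop : Continuous fun ξ : ℝ => (t, ξ))
  have h2 := (continuous_duhamel hT c A B).comp (by fun_prop : Continuous fun ξ : ℝ => (t, ξ))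
  exact (h1.mul hg).add (h2.const_mul _)

/-- A crude bound, keeping the factor `|ξ|` but valid for times outside `[0, T]` too:
differentiation under the integral uses a two-sided neighbourhood of each time. -/
theorem exists_norm_forced_le (hT : 0 ≤ T) (c r : ℝ) {g : ℝ → ℂ} (hg : ExpDecay g) (A B : Amp)
    (R : ℝ) : ∃ M : ℝ, ∀ t, |t| ≤ R → ∀ ξ,
      ‖forced T c r g A B t ξ‖ ≤ M * ((1 + |ξ|) * Real.exp (-|ξ|)) := by
  obtain ⟨_, M, hM⟩ := hg
  refine ⟨|M| + |r| * (8 * Real.pi ^ 2 * (‖A‖ * ‖B‖)) * |R|, fun t ht ξ => ?_⟩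
  have h1 : ‖airy c t ξ * g ξ‖ ≤ |M| * Real.exp (-|ξ|) := by
    rw [norm_mul, norm_airy, one_mul]
    exact (hM ξ).trans (mul_le_mul_of_nonneg_right (le_abs_self _) (Real.exp_pos _).le)
  have h2 : ‖(r : ℂ) * duhamel T c A B t ξ‖
      ≤ |r| * (8 * Real.pi ^ 2 * (‖A‖ * ‖B‖) * (|ξ| * Real.exp (-|ξ|)) * |R|) := by
    rw [norm_mul, Complex.norm_real, Real.norm_eq_abs]
    refine mul_le_mul_of_nonneg_left ((norm_duhamel_le_exp hT c A B t ξ).trans ?_) (abs_nonneg _)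
    exact mul_le_mul_of_nonneg_left (ht.trans (le_abs_self _)) (by positivity)
  refine (norm_add_le _ _).trans ((add_le_add h1 h2).trans ?_)
  have e := (Real.exp_pos (-|ξ|)).le
  have k1 : 0 ≤ |M| * (|ξ| * Real.exp (-|ξ|)) := by positivity
  have k2 : 0 ≤ |r| * (8 * Real.pi ^ 2 * (‖A‖ * ‖B‖)) * |R| * Real.exp (-|ξ|) := by positivity
  linarith

theorem continuous_src_right (hT : 0 ≤ T) (A B : Amp) (t : ℝ) : Continuous (src T A B t) :=
  (continuous_src hT A B).comp (by fun_prop : Continuous fun ξ : ℝ => (t, ξ))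

theorem norm_cube (ξ : ℝ) : ‖(cube ξ : ℂ)‖ = (2 * Real.pi) ^ 3 * |ξ| ^ 3 := by
  rw [Complex.norm_real, cube, norm_pow, norm_mul, mul_pow, Real.norm_eq_abs, Real.norm_eq_abs,
    abs_of_pos Real.two_pi_pos]

theorem hasDerivAt_fourierInv_forced (hT : 0 ≤ T) (c r : ℝ) {g : ℝ → ℂ} (hg : ExpDecay g)
    (A B : Amp) (t x : ℝ) :
    HasDerivAt (fun t => 𝓕⁻ (forced T c r g A B t) x)
      (𝓕⁻ (fun ξ => c * cube ξ * Complex.I * forced T c r g A B t ξ + r * src T A B t ξ) x) t := by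
  obtain ⟨M, hM⟩ := exists_norm_forced_le hT c r hg A B (|t| + 1)
  simp only [Real.fourierInv_eq']
  have hcont : ∀ t, Continuous (forced T c r g A B t) := continuous_forced hT c r hg.1 A B
  have hcube := continuous_cube
  have hsrc := continuous_src_right hT A B
  have hexp : Continuous fun ξ : ℝ =>
      Complex.exp (((2 * Real.pi * inner ℝ ξ x : ℝ) : ℂ) * Complex.I) := by fun_prop
  have hnorm : ∀ ξ : ℝ, ‖Complex.exp (((2 * Real.pi * inner ℝ ξ x : ℝ) : ℂ) * Complex.I)‖ = 1 :=
    fun ξ => Complex.norm_exp_ofReal_mul_I _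
  have hint : Integrable fun ξ : ℝ => M * ((1 + |ξ|) * Real.exp (-|ξ|)) := by
    refine (((integrable_abs_pow_mul_exp 0).add (integrable_abs_pow_mul_exp 1)).const_mul M).congr
      (Filter.Eventually.of_forall fun ξ => ?_)
    simp only [Pi.add_apply]; ring
  have hball : ∀ s ∈ Metric.ball t 1, |s| ≤ |t| + 1 := fun s hs => by
    rw [Metric.mem_ball, Real.dist_eq] at hs
    have := abs_sub_abs_le_abs_sub s t
    linarith
  refine (hasDerivAt_integral_of_dominated_loc_of_deriv_le (Metric.ball_mem_nhds t one_pos)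
    (μ := volume)
    (F := fun s ξ => Complex.exp (((2 * Real.pi * inner ℝ ξ x : ℝ) : ℂ) * Complex.I)
      • forced T c r g A B s ξ)
    (F' := fun s ξ => Complex.exp (((2 * Real.pi * inner ℝ ξ x : ℝ) : ℂ) * Complex.I)
      • (c * cube ξ * Complex.I * forced T c r g A B s ξ + r * src T A B s ξ))
    -- The cubic symbol times the factor `1 + |ξ|` gives the powers 3 and 4; the source gives the
    -- power 1.
    (bound := fun ξ => |c| * (2 * Real.pi) ^ 3 * M * (|ξ| ^ 3 * Real.exp (-|ξ|))
      + |c| * (2 * Real.pi) ^ 3 * M * (|ξ| ^ 4 * Real.exp (-|ξ|))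
      + |r| * (8 * Real.pi ^ 2 * (‖A‖ * ‖B‖)) * (|ξ| ^ 1 * Real.exp (-|ξ|)))
    (Filter.Eventually.of_forall fun s => (hexp.smul (hcont s)).aestronglyMeasurable)
    ?_ ?_ ?_ ?_ ?_).2
  · refine hint.mono' (hexp.smul (hcont t)).aestronglyMeasurable
      (Filter.Eventually.of_forall fun ξ => ?_)
    rw [norm_smul, hnorm, one_mul]
    exact hM t (by linarith) ξ
  · refine (hexp.smul ?_).aestronglyMeasurable
    have := hcont t
    have := hsrc t
    fun_prop
  · refine Filter.Eventually.of_forall fun ξ s hs => ?_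
    rw [norm_smul, hnorm, one_mul]
    refine (norm_add_le _ _).trans ?_
    rw [norm_mul, norm_mul, norm_mul, norm_mul, Complex.norm_I, norm_cube, Complex.norm_real,
      Complex.norm_real, Real.norm_eq_abs, Real.norm_eq_abs, mul_one]
    have h1 := mul_le_mul_of_nonneg_left (hM s (hball s hs) ξ)
      (by positivity : 0 ≤ |c| * ((2 * Real.pi) ^ 3 * |ξ| ^ 3))
    have h2 := mul_le_mul_of_nonneg_left (norm_src_le_exp hT A B s ξ) (abs_nonneg r)
    linarith
  · exact (((integrable_abs_pow_mul_exp 3).const_mul _).add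
      ((integrable_abs_pow_mul_exp 4).const_mul _)).add
      ((integrable_abs_pow_mul_exp 1).const_mul _)
  · refine Filter.Eventually.of_forall fun ξ s _ => ?_
    simpa only [smul_eq_mul] using (hasDerivAt_forced hT c r g A B s ξ).const_mul
      (Complex.exp (((2 * Real.pi * inner ℝ ξ x : ℝ) : ℂ) * Complex.I))

theorem fourierInv_mul_src (hT : 0 ≤ T) (A B : Amp) (t x : ℝ) :
    𝓕⁻ (src T A B t) x = -deriv (fun y => 𝓕⁻ (coef T A t) y * 𝓕⁻ (coef T B t) y) x := by
  have h : (fun y => 𝓕⁻ (coef T A t) y * 𝓕⁻ (coef T B t) y) = 𝓕⁻ (conv T A B t) := by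
    ext y; rw [fourierInv_conv hT]
  rw [h, ← iteratedDeriv_one, iteratedDeriv_fourierInv (expDecay_conv hT A B t), Real.fourierInv_eq',
    Real.fourierInv_eq', ← integral_neg]
  congr 1
  ext ξ
  simp only [src, smul_eq_mul, pow_one]
  ring

theorem fourierInv_forced_rhs (hT : 0 ≤ T) (c r : ℝ) {f : ℝ → ℂ} (hf : ExpDecay f)
    (A B : Amp) (t x : ℝ) :
    𝓕⁻ (fun ξ => c * cube ξ * Complex.I * f ξ + r * src T A B t ξ) x
      = -(c * iteratedDeriv 3 (𝓕⁻ f) x)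
        - r * deriv (fun y => 𝓕⁻ (coef T A t) y * 𝓕⁻ (coef T B t) y) x := by
  have hsrc : Integrable (src T A B t) := by
    refine (((expDecay_conv hT A B t).integrable_pow_mul 1).const_mul
      (-(2 * Real.pi * Complex.I))).congr (Filter.Eventually.of_forall fun ξ => ?_)
    simp only [src]; ring
  have hcube : Integrable fun ξ : ℝ => (2 * Real.pi * Complex.I * ξ) ^ 3 * f ξ := by
    refine ((hf.integrable_pow_mul 3).const_mul
      ((2 * Real.pi * Complex.I) ^ 3)).congr (Filter.Eventually.of_forall fun ξ => ?_)
    simp only; ring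
  have h1 : (fun ξ : ℝ => c * cube ξ * Complex.I * f ξ + r * src T A B t ξ)
      = (-(c : ℂ)) • (fun ξ : ℝ => (2 * Real.pi * Complex.I * ξ) ^ 3 * f ξ)
        + (r : ℂ) • src T A B t := by
    ext ξ
    simp only [Pi.add_apply, Pi.smul_apply, smul_eq_mul, cube]
    have : Complex.I ^ 3 = -Complex.I := Complex.I_pow_three
    push_cast
    linear_combination (c * (2 * Real.pi * ξ) ^ 3 * f ξ : ℂ) * this
  have hadd : ∀ p q : ℝ → ℂ, Integrable p → Integrable q → ∀ a b : ℂ,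
      𝓕⁻ (a • p + b • q) x = a * 𝓕⁻ p x + b * 𝓕⁻ q x := by
    intro p q hp hq a b
    have hexp : ∀ p : ℝ → ℂ, Integrable p → Integrable fun ξ : ℝ =>
        Complex.exp (((2 * Real.pi * inner ℝ ξ x : ℝ) : ℂ) * Complex.I) • p ξ := by
      intro p hp
      refine hp.bdd_mul (c := 1) (Continuous.aestronglyMeasurable (by fun_prop))
        (Filter.Eventually.of_forall fun ξ => (Complex.norm_exp_ofReal_mul_I _).le)
    rw [Real.fourierInv_eq', Real.fourierInv_eq', Real.fourierInv_eq', ← integral_const_mul,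
      ← integral_const_mul, ← integral_add ((hexp p hp).const_mul a) ((hexp q hq).const_mul b)]
    congr 1
    ext ξ
    simp only [Pi.add_apply, Pi.smul_apply, smul_eq_mul]; ring
  rw [h1, hadd _ _ hcube hsrc, iteratedDeriv_fourierInv hf, fourierInv_mul_src hT]
  ring

theorem hasDerivWithinAt_of_forced (hT : 0 ≤ T) (c r : ℝ) {g : ℝ → ℂ} (hg : ExpDecay g)
    (A B C : Amp) (hC : ∀ t ∈ Icc 0 T, ∀ ξ, coef T C t ξ = forced T c r g A B t ξ)
    {t : ℝ} (ht : t ∈ Icc 0 T) (x : ℝ) :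
    HasDerivWithinAt (fun t => 𝓕⁻ (coef T C t) x)
      (-(c * iteratedDeriv 3 (𝓕⁻ (coef T C t)) x)
        - r * deriv (fun y => 𝓕⁻ (coef T A t) y * 𝓕⁻ (coef T B t) y) x) (Icc 0 T) t := by
  have h : ∀ t ∈ Icc 0 T, coef T C t = forced T c r g A B t := fun t ht => funext (hC t ht)
  have h1 := (hasDerivAt_fourierInv_forced hT c r hg A B t x).hasDerivWithinAt (s := Icc 0 T)
  have h2 : ExpDecay (forced T c r g A B t) := h t ht ▸ expDecay_coef hT C t
  rw [fourierInv_forced_rhs hT c r h2, ← h t ht] at h1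
  exact h1.congr (fun s hs => by rw [h s hs]) (by rw [h t ht])

end

/-! ### Sobolev paths and smooth solutions from amplitudes -/

section

variable {T : ℝ} {𝔽 : Subalgebra ℝ ℂ} {σ : ℝ}

/-- The Fourier coefficients at time `t` of a path with given amplitude. -/
noncomputable def slice (hT : 0 ≤ T) (t : ℝ) : realAmp →ₗ[ℝ] fourierData where
  toFun A := ⟨coef T A t, expDecay_coef hT A t, coef_neg A t⟩
  map_add' A B := Subtype.ext <| funext fun ξ => coef_add (T := T) A B t ξ
  map_smul' c A := Subtype.ext <| funext fun ξ => by
    simpa using coef_smul (T := T) c A t ξ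

theorem slice_apply (hT : 0 ≤ T) (t : ℝ) (A : realAmp) :
    (slice hT t A : ℝ → ℂ) = coef T A t := rfl

/-- The constant in the embedding of exponentially decaying functions into `H^σ`. -/
noncomputable def decayConst (σ : ℝ) : ℝ := ∫ ξ : ℝ, (1 + ξ ^ 2) ^ σ * Real.exp (-|ξ|)

theorem decayConst_nonneg (σ : ℝ) : 0 ≤ decayConst σ :=
  integral_nonneg fun ξ => by positivity

theorem weight_mul_sq_le {z : ℂ} {M ξ : ℝ} (h : ‖z‖ ≤ M * Real.exp (-|ξ|)) :
    (1 + ξ ^ 2) ^ σ * ‖z‖ ^ 2 ≤ M ^ 2 * ((1 + ξ ^ 2) ^ σ * Real.exp (-|ξ|)) := by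
  have h2 : ‖z‖ ^ 2 ≤ M ^ 2 * Real.exp (-|ξ|) := by
    calc ‖z‖ ^ 2 ≤ (M * Real.exp (-|ξ|)) ^ 2 := pow_le_pow_left₀ (norm_nonneg _) h 2
      _ = M ^ 2 * (Real.exp (-|ξ|) * Real.exp (-|ξ|)) := by ring
      _ ≤ M ^ 2 * (Real.exp (-|ξ|) * 1) := by
        gcongr; exact Real.exp_le_one_iff.mpr (by simp)
      _ = _ := by ring
  calc (1 + ξ ^ 2) ^ σ * ‖z‖ ^ 2 ≤ (1 + ξ ^ 2) ^ σ * (M ^ 2 * Real.exp (-|ξ|)) := by gcongr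
    _ = _ := by ring

theorem norm_ofFourier_slice_le (hT : 0 ≤ T) (t : ℝ) (A : realAmp) :
    ‖ofFourier 𝔽 σ (slice hT t A)‖ ≤ √(decayConst σ) * ‖A‖ := by
  refine le_of_sq_le_sq ?_ (by positivity)
  rw [norm_ofFourier_sq, mul_pow, Real.sq_sqrt (decayConst_nonneg σ), mul_comm, decayConst,
    ← integral_const_mul]
  exact integral_mono ((slice hT t A).2.1.integrable_weight σ)
    ((integrable_rpow_mul_exp σ).const_mul _)
    fun ξ => weight_mul_sq_le (norm_coef_le_exp hT A t ξ)

theorem continuous_ofFourier_slice (hT : 0 ≤ T) (A : realAmp) :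
    Continuous fun t => ofFourier 𝔽 σ (slice hT t A) := by
  refine continuous_iff_continuousAt.mpr fun t₀ => ?_
  rw [ContinuousAt, tendsto_iff_norm_sub_tendsto_zero]
  have hsq : ∀ t, ‖ofFourier 𝔽 σ (slice hT t A) - ofFourier 𝔽 σ (slice hT t₀ A)‖
      = √(∫ ξ, (1 + ξ ^ 2) ^ σ * ‖coef T A t ξ - coef T A t₀ ξ‖ ^ 2) := fun t => by
    rw [← map_sub, ← Real.sqrt_sq (norm_nonneg _), norm_ofFourier_sq]
    rfl
  have hcont : Continuous fun t =>
      √(∫ ξ, (1 + ξ ^ 2) ^ σ * ‖coef T A t ξ - coef T A t₀ ξ‖ ^ 2) := by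
    refine Real.continuous_sqrt.comp (continuous_of_dominated
      (bound := fun ξ => (2 * ‖A‖) ^ 2 * ((1 + ξ ^ 2) ^ σ * Real.exp (-|ξ|))) ?_ ?_ ?_ ?_)
    · intro t
      have h1 := continuous_one_add_sq_rpow σ
      have h2 := continuous_coef_right (T := T) A t
      have h3 := continuous_coef_right (T := T) A t₀
      exact Continuous.aestronglyMeasurable (by fun_prop)
    · refine fun t => Filter.Eventually.of_forall fun ξ => ?_
      rw [Real.norm_of_nonneg (by positivity)]
      refine weight_mul_sq_le ((norm_sub_le _ _).trans ?_)
      have h1 := norm_coef_le_exp hT (A : Amp) t ξ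
      have h2 := norm_coef_le_exp hT (A : Amp) t₀ ξ
      have h3 : ‖(A : Amp)‖ = ‖A‖ := rfl
      rw [h3] at h1 h2
      linarith
    · exact (integrable_rpow_mul_exp σ).const_mul _
    · refine Filter.Eventually.of_forall fun ξ => ?_
      have h1 := (continuous_coef (T := T) A).comp (by fun_prop : Continuous fun t : ℝ => (t, ξ))
      exact continuous_const.mul ((h1.sub continuous_const).norm.pow 2)
  simp only [hsq]
  simpa using hcont.tendsto t₀

/-- The path in `H^σ × H^σ` with given amplitudes. -/
noncomputable def pathL (hT : 0 ≤ T) (𝔽 : Subalgebra ℝ ℂ) (σ : ℝ) :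
    realAmp × realAmp →L[ℝ] PathSpace 𝔽 σ T :=
  LinearMap.mkContinuous
    { toFun := fun w => ⟨fun t => (ofFourier 𝔽 σ (slice hT t w.1), ofFourier 𝔽 σ (slice hT t w.2)),
        ((continuous_ofFourier_slice hT w.1).comp continuous_subtype_val).prodMk
          ((continuous_ofFourier_slice hT w.2).comp continuous_subtype_val)⟩
      map_add' := fun w w' => by ext t <;> simp
      map_smul' := fun c w => by ext t <;> simp }
    √(decayConst σ) fun w => by
      rw [ContinuousMap.norm_le _ (by positivity)]
      intro t
      refine max_le ((norm_ofFourier_slice_le hT t w.1).trans ?_)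
        ((norm_ofFourier_slice_le hT t w.2).trans ?_)
      · exact mul_le_mul_of_nonneg_left (norm_fst_le w) (Real.sqrt_nonneg _)
      · exact mul_le_mul_of_nonneg_left (norm_snd_le w) (Real.sqrt_nonneg _)

theorem pathL_apply (hT : 0 ≤ T) (w : realAmp × realAmp) (t : Icc (0 : ℝ) T) :
    pathL hT 𝔽 σ w t = (ofFourier 𝔽 σ (slice hT t w.1), ofFourier 𝔽 σ (slice hT t w.2)) := rfl

theorem pathIsGivenBy_pathL (hT : 0 ≤ T) (w : realAmp × realAmp) :
    PathIsGivenBy (pathL hT 𝔽 σ w) (fun t => 𝓕⁻ (coef T w.1 t)) (fun t => 𝓕⁻ (coef T w.2 t)) :=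
  fun t => ⟨isGivenBy_ofFourier (slice hT t w.1), isGivenBy_ofFourier (slice hT t w.2)⟩

/-- The quadratic part of the integrated system. -/
noncomputable def bilin (hT : 0 ≤ T) (w z : realAmp × realAmp) : realAmp × realAmp :=
  ((1 / 2 : ℝ) • duhamelAmp hT 1 w.2 z.2, duhamelAmp hT 4 w.1 z.2)

theorem isBoundedBilinearMap_bilin (hT : 0 ≤ T) :
    IsBoundedBilinearMap ℝ fun p : (realAmp × realAmp) × (realAmp × realAmp) =>
      bilin hT p.1 p.2 where
  add_left w w' z := by
    simp only [bilin, Prod.fst_add, Prod.snd_add, duhamelAmp_add_left, smul_add, Prod.mk_add_mk]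
  smul_left c w z := by
    simp only [bilin, Prod.smul_fst, Prod.smul_snd, duhamelAmp_smul_left, Prod.smul_mk,
      smul_comm c]
  add_right w z z' := by
    simp only [bilin, Prod.snd_add, duhamelAmp_add_right, smul_add, Prod.mk_add_mk]
  smul_right c w z := by
    simp only [bilin, Prod.smul_snd, duhamelAmp_smul_right, Prod.smul_mk, smul_comm c]
  bound := by
    refine ⟨8 * Real.pi ^ 2, by positivity, fun w z => ?_⟩
    have h1 : ‖duhamelAmp hT 1 w.2 z.2‖ ≤ 8 * Real.pi ^ 2 * ‖w‖ * ‖z‖ :=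
      (norm_duhamelAmp_le hT 1 _ _).trans (by gcongr; exacts [norm_snd_le w, norm_snd_le z])
    have h2 : ‖duhamelAmp hT 4 w.1 z.2‖ ≤ 8 * Real.pi ^ 2 * ‖w‖ * ‖z‖ :=
      (norm_duhamelAmp_le hT 4 _ _).trans (by gcongr; exacts [norm_fst_le w, norm_snd_le z])
    refine max_le ?_ h2
    change ‖(1 / 2 : ℝ) • duhamelAmp hT 1 w.2 z.2‖ ≤ _
    rw [norm_smul, Real.norm_of_nonneg (by norm_num)]
    linarith [norm_nonneg (duhamelAmp hT 1 w.2 z.2)]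

/-- The solutions of the integrated system are smooth solutions. -/
theorem isSmoothSolution (hT : 0 ≤ T) {g : ℝ → ℂ} (hg : ExpDecay g) (w l : realAmp × realAmp)
    (hl1 : l.1 = 0) (hl2 : ∀ t ∈ Icc 0 T, ∀ ξ, coef T l.2 t ξ = airy 4 t ξ * g ξ)
    (hw : w = l + bilin hT w w) :
    IsSmoothSolution 𝔽 4 0 T (fun t => 𝓕⁻ (coef T w.1 t)) (fun t => 𝓕⁻ (coef T w.2 t)) := by
  have h1 : ∀ t ∈ Icc 0 T, ∀ ξ, coef T w.1 t ξ = forced T 1 (1 / 2) 0 w.2 w.2 t ξ := by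
    intro t ht ξ
    have : w.1 = (1 / 2 : ℝ) • duhamelAmp hT 1 w.2 w.2 := by
      conv_lhs => rw [hw, bilin, Prod.fst_add, hl1, zero_add]
    conv_lhs => rw [this]
    rw [Submodule.coe_smul, coef_smul, coef_duhamelAmp hT 1 _ _ ht, forced]
    simp
  have h2 : ∀ t ∈ Icc 0 T, ∀ ξ, coef T w.2 t ξ = forced T 4 1 g w.1 w.2 t ξ := by
    intro t ht ξ
    have : w.2 = l.2 + duhamelAmp hT 4 w.1 w.2 := by
      conv_lhs => rw [hw, bilin, Prod.snd_add]
    conv_lhs => rw [this]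
    rw [Submodule.coe_add, coef_add, coef_duhamelAmp hT 4 _ _ ht, forced, hl2 t ht]
    simp
  refine ⟨fun t _ => contDiff_fourierInv (expDecay_coef hT _ t),
    fun t _ => contDiff_fourierInv (expDecay_coef hT _ t),
    fun σ => ⟨pathL hT 𝔽 σ w, pathIsGivenBy_pathL hT w⟩, fun t ht x => ?_, fun t ht x => ?_⟩
  · have h := hasDerivWithinAt_of_forced hT 1 (1 / 2) (g := 0)
      ⟨continuous_const, 0, fun ξ => by simp⟩ w.2 w.2 w.1 h1 ht x
    have hd : DifferentiableAt ℝ (𝓕⁻ (coef T w.2 t)) x :=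
      ((contDiff_fourierInv (expDecay_coef hT w.2 t)).differentiable (by simp)).differentiableAt
    -- Half the derivative of `v²` is `v v_x`, which accounts for the factor `1/2` in `bilin`.
    rw [deriv_fun_mul hd hd] at h
    convert! h using 1
    push_cast; ring
  · have h := hasDerivWithinAt_of_forced hT 4 1 hg w.1 w.2 w.2 h2 ht x
    convert! h using 1
    push_cast; ring

end

/-! ### Power expansions in the size of the data -/

section

/-- The map `w ↦ w - B w w` has derivative the identity at `0`, hence is locally onto. Only
existence is needed: uniqueness will come from well-posedness. -/
theorem exists_solution_expansion {E : Type*} [NormedAddCommGroup E] [NormedSpace ℝ E]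
    [CompleteSpace E] {B : E → E → E} (hB : IsBoundedBilinearMap ℝ fun p : E × E => B p.1 p.2)
    (l : E) : ∃ K ε₀ : ℝ, 0 < ε₀ ∧ ∀ ε : ℝ, |ε| < ε₀ →
      ∃ w : E, w = ε • l + B w w ∧ ‖w - ε • l - ε ^ 2 • B l l‖ ≤ K * |ε| ^ 3 := by
  obtain ⟨C, hC0, hC⟩ := hB.bound
  have hC : ∀ x y, ‖B x y‖ ≤ C * ‖x‖ * ‖y‖ := hC
  have hB0 : B 0 0 = 0 := by simpa using hC 0 0
  have hF : HasStrictFDerivAt (fun w : E => w - B w w) (ContinuousLinearEquiv.refl ℝ E : E →L[ℝ] E)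
      0 := by
    have hdiag : HasStrictFDerivAt (fun w : E => (w, w))
        ((ContinuousLinearMap.id ℝ E).prod (ContinuousLinearMap.id ℝ E)) 0 :=
      (hasStrictFDerivAt_id (𝕜 := ℝ) (0 : E)).prodMk (hasStrictFDerivAt_id (0 : E))
    have h := (hasStrictFDerivAt_id (𝕜 := ℝ) (0 : E)).sub
      (HasStrictFDerivAt.comp (f := fun w : E => (w, w)) (0 : E)
        (hB.hasStrictFDerivAt ((0 : E), (0 : E))) hdiag)
    convert! h using 1
    ext x
    simp only [ContinuousLinearEquiv.coe_refl, sub_apply,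
      ContinuousLinearMap.comp_apply, ContinuousLinearMap.prod_apply, ContinuousLinearMap.id_apply,
      hB.deriv_apply]
    have h1 : B 0 x = 0 := by simpa using hC 0 x
    have h2 : B x 0 = 0 := by simpa using hC x 0
    simp [h1, h2]
  have hmap := hF.map_nhds_eq_of_equiv
  -- In this ball `‖B w w‖ ≤ ‖w‖ / 2`, so the quadratic term is absorbed and `‖w‖ ≤ 2 |ε| ‖l‖`.
  have hr : 0 < 1 / (2 * C) := by positivity
  have himg : (fun w : E => w - B w w) '' Metric.ball 0 (1 / (2 * C)) ∈ 𝓝 (0 : E) := by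
    have := Filter.image_mem_map (m := fun w : E => w - B w w) (Metric.ball_mem_nhds (0 : E) hr)
    rw [hmap] at this
    simpa [hB0] using this
  have hlim : Filter.Tendsto (fun ε : ℝ => ε • l) (𝓝 0) (𝓝 0) := by
    have : Continuous fun ε : ℝ => ε • l := by fun_prop
    simpa using this.tendsto 0
  obtain ⟨ε₀, hε₀, hball⟩ := Metric.mem_nhds_iff.mp (hlim himg)
  refine ⟨12 * C ^ 2 * ‖l‖ ^ 3, ε₀, hε₀, fun ε hε => ?_⟩
  obtain ⟨w, hw, hwl⟩ := hball (by simpa using hε : ε ∈ Metric.ball (0 : ℝ) ε₀)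
  have hwl : w - B w w = ε • l := hwl
  have hfix : w = ε • l + B w w := by rw [← hwl]; abel
  refine ⟨w, hfix, ?_⟩
  have hCw : C * ‖w‖ ≤ 1 / 2 := by
    have : ‖w‖ < 1 / (2 * C) := by simpa using hw
    rw [lt_div_iff₀ (by positivity)] at this
    linarith
  have hwle : ‖w‖ ≤ 2 * (|ε| * ‖l‖) := by
    have h1 : ‖w‖ ≤ |ε| * ‖l‖ + ‖B w w‖ := by
      conv_lhs => rw [hfix]
      refine (norm_add_le _ _).trans_eq ?_
      rw [norm_smul, Real.norm_eq_abs]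
    nlinarith [hC w w, norm_nonneg w]
  have hd : ‖w - ε • l‖ ≤ C * (2 * (|ε| * ‖l‖)) * (2 * (|ε| * ‖l‖)) := by
    have : w - ε • l = B w w := by rw [← hwl]; abel
    rw [this]
    exact (hC w w).trans (by gcongr)
  -- Each term pairs a factor of order `ε` with one of order `ε²`; they contribute `8` and `4` to
  -- the constant `12`.
  have hsplit : w - ε • l - ε ^ 2 • B l l = B (w - ε • l) w + B (ε • l) (w - ε • l) := by
    have a1 := hB.map_sub_left (x := w) (y := ε • l) (z := w)
    have a2 := hB.map_sub_right (x := ε • l) (y := w) (z := ε • l)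
    have a3 := hB.smul_left ε l (ε • l)
    have a4 := hB.smul_right ε l l
    simp only at a1 a2 a3 a4
    rw [a1, a2, a3, a4, smul_smul, ← pow_two]
    have : w - ε • l = B w w := by rw [← hwl]; abel
    rw [this]; abel
  have hεl : ‖ε • l‖ = |ε| * ‖l‖ := by rw [norm_smul, Real.norm_eq_abs]
  rw [hsplit]
  have hn : 0 ≤ C * (2 * (|ε| * ‖l‖)) * (2 * (|ε| * ‖l‖)) := by positivity
  calc ‖B (w - ε • l) w + B (ε • l) (w - ε • l)‖
      ≤ C * ‖w - ε • l‖ * ‖w‖ + C * ‖ε • l‖ * ‖w - ε • l‖ :=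
        (norm_add_le _ _).trans (add_le_add (hC _ _) (hC _ _))
    _ ≤ C * (C * (2 * (|ε| * ‖l‖)) * (2 * (|ε| * ‖l‖))) * (2 * (|ε| * ‖l‖))
        + C * (|ε| * ‖l‖) * (C * (2 * (|ε| * ‖l‖)) * (2 * (|ε| * ‖l‖))) := by
        rw [hεl]; gcongr
    _ = 12 * C ^ 2 * ‖l‖ ^ 3 * |ε| ^ 3 := by ring

/-- The derivative is `C¹`, hence Lipschitz near `0`; the mean value inequality on the ball of
radius `‖f‖` gives the second factor `‖f‖`. -/
theorem exists_quadratic_remainder {E F : Type*} [NormedAddCommGroup E] [NormedSpace ℝ E]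
    [NormedAddCommGroup F] [NormedSpace ℝ F] {Φ : E → F} (hΦ : ContDiffAt ℝ 2 Φ 0) :
    ∃ (L : E →L[ℝ] F) (C r : ℝ), 0 ≤ C ∧ 0 < r ∧
      ∀ f, ‖f‖ < r → ‖Φ f - Φ 0 - L f‖ ≤ C * ‖f‖ ^ 2 := by
  have h1 : ContDiffAt ℝ 1 (fderiv ℝ Φ) 0 := hΦ.fderiv_right (by norm_num)
  obtain ⟨K, t, ht, hK⟩ := h1.exists_lipschitzOnWith
  have hdiff : ∀ᶠ x in 𝓝 (0 : E), DifferentiableAt ℝ Φ x :=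
    (hΦ.eventually (by simp)).mono fun x hx => hx.differentiableAt (by simp)
  obtain ⟨r, hr, hball⟩ := Metric.mem_nhds_iff.mp (Filter.inter_mem ht hdiff)
  refine ⟨fderiv ℝ Φ 0, K, r, K.2, hr, fun f hf => ?_⟩
  have hsub : Metric.closedBall (0 : E) ‖f‖ ⊆ Metric.ball 0 r := Metric.closedBall_subset_ball hf
  have hmv := (convex_closedBall (0 : E) ‖f‖).norm_image_sub_le_of_norm_hasFDerivWithin_le'
    (f := Φ) (f' := fderiv ℝ Φ) (φ := fderiv ℝ Φ 0) (C := K * ‖f‖) (x := 0) (y := f)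
    (fun x hx => (hball (hsub hx)).2.hasFDerivAt.hasFDerivWithinAt)
    (fun x hx => by
      have := hK.norm_sub_le (hball (hsub hx)).1 (mem_of_mem_nhds ht)
      rw [sub_zero] at this
      refine this.trans (mul_le_mul_of_nonneg_left ?_ K.2)
      simpa using hx)
    (by simp) (by simp)
  rw [sub_zero] at hmv
  exact hmv.trans_eq (by ring)

/-- Comparison of the two expansions of `Φ (ε • f)` order by order identifies `p` with the
derivative along `f`, then bounds `q`. The constants `K` and `ε₀` may depend on `f` since they
disappear as `ε → 0`; `C` does not. -/
theorem exists_quadratic_bound {E F : Type*} [NormedAddCommGroup E] [NormedSpace ℝ E]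
    [NormedAddCommGroup F] [NormedSpace ℝ F] {Φ : E → F} (hΦ : ContDiffAt ℝ 2 Φ 0) :
    ∃ C : ℝ, 0 ≤ C ∧ ∀ (f : E) (p q : F) (K ε₀ : ℝ), 0 < ε₀ →
      (∀ ε : ℝ, |ε| < ε₀ → ‖Φ (ε • f) - ε • p - ε ^ 2 • q‖ ≤ K * |ε| ^ 3) →
      ‖q‖ ≤ C * ‖f‖ ^ 2 := by
  obtain ⟨L, C, r, hC, hr, hL⟩ := exists_quadratic_remainder hΦ
  refine ⟨C, hC, fun f p q K ε₀ hε₀ h => ?_⟩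
  have hΦ0 : Φ 0 = 0 := by simpa using h 0 (by simpa using hε₀)
  have hev : ∀ᶠ ε : ℝ in 𝓝[>] 0,
      ‖ε • (p - L f) + ε ^ 2 • q‖ ≤ C * ‖f‖ ^ 2 * ε ^ 2 + K * ε ^ 3 := by
    have hlim : Filter.Tendsto (fun ε : ℝ => ‖ε • f‖) (𝓝 0) (𝓝 0) := by
      have : Continuous fun ε : ℝ => ‖ε • f‖ := by fun_prop
      simpa using this.tendsto 0
    filter_upwards [nhdsWithin_le_nhds (hlim.eventually (gt_mem_nhds hr)),
      nhdsWithin_le_nhds (gt_mem_nhds hε₀), self_mem_nhdsWithin] with ε h1 h2 h3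
    have h3 : 0 < ε := h3
    have a := h ε (by rwa [abs_of_pos h3])
    have b := hL _ h1
    rw [hΦ0, sub_zero, map_smul, norm_smul, Real.norm_eq_abs, abs_of_pos h3] at b
    rw [abs_of_pos h3] at a
    have e : ε • (p - L f) + ε ^ 2 • q
        = (Φ (ε • f) - ε • L f) - (Φ (ε • f) - ε • p - ε ^ 2 • q) := by
      rw [smul_sub]; abel
    rw [e]
    refine (norm_sub_le _ _).trans ((add_le_add b a).trans_eq (by ring))
  have hp : p - L f = 0 := by
    have hle : ∀ᶠ ε : ℝ in 𝓝[>] 0, ‖p - L f + ε • q‖ ≤ C * ‖f‖ ^ 2 * ε + K * ε ^ 2 := by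
      filter_upwards [hev, self_mem_nhdsWithin] with ε h1 h3
      have h3 : 0 < ε := h3
      have e : ε • (p - L f) + ε ^ 2 • q = ε • (p - L f + ε • q) := by
        rw [smul_add, smul_smul, pow_two]
      rw [e, norm_smul, Real.norm_eq_abs, abs_of_pos h3] at h1
      refine le_of_mul_le_mul_left (h1.trans_eq ?_) h3
      ring
    have l1 : Filter.Tendsto (fun ε : ℝ => ‖p - L f + ε • q‖) (𝓝[>] 0) (𝓝 ‖p - L f‖) := by
      have : Continuous fun ε : ℝ => ‖p - L f + ε • q‖ := by fun_prop
      simpa using (this.tendsto 0).mono_left nhdsWithin_le_nhds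
    have l2 : Filter.Tendsto (fun ε : ℝ => C * ‖f‖ ^ 2 * ε + K * ε ^ 2) (𝓝[>] 0) (𝓝 0) := by
      have : Continuous fun ε : ℝ => C * ‖f‖ ^ 2 * ε + K * ε ^ 2 := by fun_prop
      simpa using (this.tendsto 0).mono_left nhdsWithin_le_nhds
    exact norm_le_zero_iff.mp (le_of_tendsto_of_tendsto l1 l2 hle)
  have hle : ∀ᶠ ε : ℝ in 𝓝[>] 0, ‖q‖ ≤ C * ‖f‖ ^ 2 + K * ε := by
    filter_upwards [hev, self_mem_nhdsWithin] with ε h1 h3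
    have h3 : 0 < ε := h3
    rw [hp, smul_zero, zero_add, norm_smul, Real.norm_of_nonneg (by positivity)] at h1
    refine le_of_mul_le_mul_left (h1.trans_eq ?_) (by positivity : 0 < ε ^ 2)
    ring
  have l2 : Filter.Tendsto (fun ε : ℝ => C * ‖f‖ ^ 2 + K * ε) (𝓝[>] 0) (𝓝 (C * ‖f‖ ^ 2)) := by
    have : Continuous fun ε : ℝ => C * ‖f‖ ^ 2 + K * ε := by fun_prop
    simpa using (this.tendsto 0).mono_left nhdsWithin_le_nhds
  exact ge_of_tendsto l2 hle

/-! ### The quadratic estimate forced by well-posedness -/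

variable {T : ℝ} {𝔽 : Subalgebra ℝ ℂ} {s : ℝ}

theorem wt_zero_le (hT : 0 ≤ T) (t ξ : ℝ) : wt T 0 ξ ≤ wt T t ξ := by
  unfold wt
  have h0 : clamp T 0 = 0 := clamp_of_mem ⟨le_rfl, hT⟩
  rw [h0]
  gcongr
  exact clamp_nonneg T t

theorem exists_norm_le_wt (T : ℝ) {g : ℝ → ℂ} (hg : Continuous g) (hc : HasCompactSupport g) :
    ∃ M : ℝ, 0 ≤ M ∧ ∀ ξ, ‖g ξ‖ ≤ M * wt T 0 ξ := by
  have hw : Continuous fun ξ : ℝ => ((wt T 0 ξ : ℝ) : ℂ)⁻¹ * g ξ := by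
    have h := (continuous_wt T).comp (by fun_prop : Continuous fun ξ : ℝ => ((0 : ℝ), ξ))
    exact ((Complex.continuous_ofReal.comp h).inv₀ fun ξ => by
      exact Complex.ofReal_ne_zero.mpr (wt_pos T 0 ξ).ne').mul hg
  obtain ⟨M, hM⟩ := (hc.mul_left (f := fun ξ : ℝ => ((wt T 0 ξ : ℝ) : ℂ)⁻¹)).exists_bound_of_continuous hw
  refine ⟨M, (norm_nonneg _).trans (hM 0), fun ξ => ?_⟩
  have := hM ξ
  rw [Pi.mul_apply, norm_mul, norm_inv, Complex.norm_real, Real.norm_of_nonneg (wt_pos T 0 ξ).le,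
    inv_mul_le_iff₀ (wt_pos T 0 ξ)] at this
  linarith

/-- The free flow preserves moduli and the weight is smallest at time `0`; compact support makes `g`
dominated there for any `T`. -/
theorem exists_free_amp (hT : 0 ≤ T) {g : ℝ → ℂ} (hg : Continuous g) (hc : HasCompactSupport g)
    (hg' : ∀ ξ, g (-ξ) = conj (g ξ)) :
    ∃ A : realAmp, ∀ t ∈ Icc 0 T, ∀ ξ, coef T A t ξ = airy 4 t ξ * g ξ := by
  obtain ⟨M, hM0, hM⟩ := exists_norm_le_wt T hg hc
  have hcont : Continuous fun p : ℝ × ℝ => airy 4 p.1 p.2 * g p.2 :=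
    (continuous_airy 4).mul (hg.comp continuous_snd)
  have hb : ∀ t ∈ Icc 0 T, ∀ ξ, ‖airy 4 t ξ * g ξ‖ ≤ M * wt T t ξ := fun t _ ξ => by
    rw [norm_mul, norm_airy, one_mul]
    exact (hM ξ).trans (mul_le_mul_of_nonneg_left (wt_zero_le hT t ξ) hM0)
  exact ⟨realOfBound T hT (fun t ξ => airy 4 t ξ * g ξ) hcont M hb
    (fun t ξ => by rw [airy_neg, hg', map_mul]),
    fun t ht ξ => coef_ofBound hT _ hcont M hb ht ξ⟩

theorem expDecay_of_hasCompactSupport {g : ℝ → ℂ} (hg : Continuous g) (hc : HasCompactSupport g) :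
    ExpDecay g := by
  obtain ⟨M, hM0, hM⟩ := exists_norm_le_wt 0 hg hc
  exact ⟨hg, M, fun ξ => (hM ξ).trans (mul_le_mul_of_nonneg_left (wt_le_exp le_rfl 0 ξ) hM0)⟩

theorem coef_zero_bilin (hT : 0 ≤ T) (w z : realAmp × realAmp) (ξ : ℝ) :
    coef T (bilin hT w z).1 0 ξ = 0 ∧ coef T (bilin hT w z).2 0 ξ = 0 := by
  have h0 : (0 : ℝ) ∈ Icc 0 T := ⟨le_rfl, hT⟩
  constructor
  · rw [bilin, Submodule.coe_smul, coef_smul, coef_duhamelAmp hT 1 _ _ h0]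
    simp [duhamel]
  · rw [bilin, coef_duhamelAmp hT 4 _ _ h0]
    simp [duhamel]

/-- The second Picard iterate of a `C²` well-posed problem is bounded quadratically. -/
theorem IsLocallyWellPosed.exists_quadratic_estimate (h : IsLocallyWellPosed 2 𝔽 4 0 s) :
    ∃ T : ℝ, 0 < T ∧ ∃ C : ℝ, 0 ≤ C ∧ ∀ (g : ℝ → ℂ), Continuous g → HasCompactSupport g →
      (∀ ξ, g (-ξ) = conj (g ξ)) → ∀ A : realAmp,
      (∀ t ∈ Icc 0 T, ∀ ξ, coef T A t ξ = airy 4 t ξ * g ξ) →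
      ∫ ξ, (1 + ξ ^ 2) ^ s * ‖(1 / 2 : ℂ) * duhamel T 1 A A T ξ‖ ^ 2
        ≤ C * (∫ ξ, (1 + ξ ^ 2) ^ s * ‖g ξ‖ ^ 2) ^ 2 := by
  -- Well-posedness is used only at zero data. This fixes `T` and `C` before `g` is chosen, so the
  -- estimate is uniform in `g`.
  obtain ⟨T, hT, U, Φ, hU, h0, hsol, hΦ⟩ := h 0
  obtain ⟨C, hC, hquad⟩ := exists_quadratic_bound (hΦ.contDiffAt (hU.mem_nhds h0))
  refine ⟨T, hT, C ^ 2, by positivity, fun g hg hc hg' A hA => ?_⟩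
  have hgd := expDecay_of_hasCompactSupport hg hc
  let g' : fourierData := ⟨g, hgd, hg'⟩
  let f : DataSpace 𝔽 s := (0, ofFourier 𝔽 s g')
  let l : realAmp × realAmp := (0, A)
  obtain ⟨K, ε₀, hε₀, hexp⟩ := exists_solution_expansion (isBoundedBilinearMap_bilin hT.le) l
  have hlim : Filter.Tendsto (fun ε : ℝ => ε • f) (𝓝 0) (𝓝 0) := by
    have : Continuous fun ε : ℝ => ε • f := continuous_id.smul continuous_const
    simpa using this.tendsto 0
  obtain ⟨ε₁, hε₁, hball⟩ := Metric.mem_nhds_iff.mp (hlim (hU.mem_nhds h0))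
  have hmain := hquad f (pathL hT.le 𝔽 s l) (pathL hT.le 𝔽 s (bilin hT.le l l))
    (‖pathL hT.le 𝔽 s‖ * K) (min ε₀ ε₁) (lt_min hε₀ hε₁) fun ε hε => by
      obtain ⟨w, hw, hwε⟩ := hexp ε (hε.trans_le (min_le_left _ _))
      have hmem : ε • f ∈ U :=
        hball (by simpa using hε.trans_le (min_le_right _ _) : ε ∈ Metric.ball (0 : ℝ) ε₁)
      have hsmooth : IsSmoothSolution 𝔽 4 0 T (fun t => 𝓕⁻ (coef T w.1 t))
          (fun t => 𝓕⁻ (coef T w.2 t)) := by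
        have hεg := (fourierData.smul_mem ε g'.2).1
        refine isSmoothSolution hT.le hεg w (ε • l) (by simp [l]) (fun t ht ξ => ?_) hw
        change coef T (ε • (A : Amp)) t ξ = _
        rw [coef_smul, hA t ht]
        simp [g']; ring
      have hdata : pathL hT.le 𝔽 s w ⟨0, left_mem_Icc.mpr hT.le⟩ = ε • f := by
        rw [pathL_apply]
        have e1 : slice hT.le 0 w.1 = 0 := Subtype.ext <| funext fun ξ => by
          rw [slice_apply, hw, Prod.fst_add, Submodule.coe_add, coef_add,
            (coef_zero_bilin hT.le w w ξ).1]
          simp [l, coef]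
        have e2 : slice hT.le 0 w.2 = ε • g' := Subtype.ext <| funext fun ξ => by
          rw [slice_apply, hw, Prod.snd_add, Submodule.coe_add, coef_add,
            (coef_zero_bilin hT.le w w ξ).2]
          change coef T (ε • (A : Amp)) 0 ξ + 0 = _
          rw [coef_smul, hA 0 ⟨le_rfl, hT.le⟩, airy_zero]
          simp [g']
        rw [e1, e2]
        simp [f]
      -- Uniqueness identifies the abstract solution map with the constructed analytic solution.
      have huniq := (hsol _ hmem).2.2 (pathL hT.le 𝔽 s w)
        (subset_closure ⟨_, _, hsmooth, pathIsGivenBy_pathL hT.le w⟩) hdata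
      rw [← huniq, ← map_smul, ← map_smul, ← map_sub, ← map_sub, mul_assoc]
      exact ((pathL hT.le 𝔽 s).le_opNorm _).trans
        (mul_le_mul_of_nonneg_left hwε (norm_nonneg _))
  have hTmem : T ∈ Icc 0 T := ⟨hT.le, le_rfl⟩
  have h1 : ‖ofFourier 𝔽 s (slice hT.le T (bilin hT.le l l).1)‖ ≤ C * ‖ofFourier 𝔽 s g'‖ ^ 2 := by
    have a := (pathL hT.le 𝔽 s (bilin hT.le l l)).norm_coe_le_norm ⟨T, hTmem⟩
    have b := (norm_fst_le (pathL hT.le 𝔽 s (bilin hT.le l l) ⟨T, hTmem⟩)).trans (a.trans hmain)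
    have c : ‖f‖ = ‖ofFourier 𝔽 s g'‖ := by simp [f, Prod.norm_def]
    rw [c] at b
    exact b
  have h2 := pow_le_pow_left₀ (norm_nonneg _) h1 2
  rw [norm_ofFourier_sq, mul_pow, norm_ofFourier_sq] at h2
  refine le_trans (le_of_eq ?_) h2
  refine integral_congr_ae (Filter.Eventually.of_forall fun ξ => ?_)
  have e : coef T (bilin hT.le l l).1 T ξ = (1 / 2 : ℂ) * duhamel T 1 A A T ξ := by
    rw [bilin, Submodule.coe_smul, coef_smul, coef_duhamelAmp hT.le 1 _ _ hTmem]
    simp [l]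
  simp only [slice_apply, e]

end

/-! ### The resonant interaction of two bumps -/

section

/-- The even tent function with peaks of width `δ` at `± N`. -/
noncomputable def tent (N δ ξ : ℝ) : ℝ := max 0 (1 - |(|ξ| - N)| / δ)

variable {T N δ : ℝ}

theorem tent_nonneg (N δ ξ : ℝ) : 0 ≤ tent N δ ξ := le_max_left _ _

theorem tent_le_one (hδ : 0 < δ) (ξ : ℝ) : tent N δ ξ ≤ 1 :=
  max_le zero_le_one (by linarith [div_nonneg (abs_nonneg (|ξ| - N)) hδ.le])

theorem abs_lt_of_tent_ne_zero (hδ : 0 < δ) {ξ : ℝ} (h : tent N δ ξ ≠ 0) : |(|ξ| - N)| < δ := by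
  by_contra! hle
  refine h (max_eq_left ?_)
  have := (one_le_div hδ).mpr hle
  linarith

theorem continuous_tent (N δ : ℝ) : Continuous (tent N δ) := by unfold tent; fun_prop

theorem tent_neg (N δ ξ : ℝ) : tent N δ (-ξ) = tent N δ ξ := by simp [tent]

theorem hasCompactSupport_tent (hδ : 0 < δ) : HasCompactSupport fun ξ => (tent N δ ξ : ℂ) := by
  refine HasCompactSupport.intro (isCompact_Icc (a := -(N + δ)) (b := N + δ)) fun ξ hξ => ?_
  by_contra h
  have h1 := abs_lt_of_tent_ne_zero hδ fun h0 => h (by rw [h0]; simp)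
  refine hξ (abs_le.mp ?_)
  linarith [(abs_lt.mp h1).2]

/-- The perfect square is special to dispersion coefficient `4`: the phase vanishes to second order
at `η = ξ/2`. -/
theorem airy_product (τ ξ η : ℝ) : airy 1 (-τ) ξ * (airy 4 τ η * airy 4 τ (ξ - η))
    = Complex.exp (((τ * ((2 * Real.pi) ^ 3 * (3 * ξ * (ξ - 2 * η) ^ 2)) : ℝ) : ℂ) * Complex.I) := by
  simp only [airy, ← Complex.exp_add]
  congr 1
  rw [← add_mul, ← add_mul, ← Complex.ofReal_add, ← Complex.ofReal_add]
  congr 2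
  simp only [cube]; ring

theorem re_ofReal_mul (r : ℝ) (z : ℂ) : ((r : ℂ) * z).re = r * z.re := by simp

theorem mul_le_norm_integral {f : ℝ → ℂ} (hT : 0 ≤ T) {z : ℂ} (hz : ‖z‖ = 1)
    (hf : IntervalIntegrable f volume 0 T) {m : ℝ} (hm : ∀ τ ∈ Icc 0 T, m ≤ (z * f τ).re) :
    T * m ≤ ‖∫ τ in (0 : ℝ)..T, f τ‖ := by
  have hre : IntervalIntegrable (fun τ => (z * f τ).re) volume 0 T :=
    ⟨(hf.const_mul z).1.re, (hf.const_mul z).2.re⟩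
  have h1 := intervalIntegral.integral_mono_on hT (intervalIntegrable_const (c := m)) hre hm
  have h2 : ∫ τ in (0 : ℝ)..T, (z * f τ).re = (z * ∫ τ in (0 : ℝ)..T, f τ).re := by
    rw [← intervalIntegral.integral_const_mul]
    exact Complex.reCLM.intervalIntegral_comp_comm (hf.const_mul z)
  rw [intervalIntegral.integral_const, smul_eq_mul, sub_zero, h2] at h1
  refine h1.trans ((Complex.re_le_norm _).trans_eq ?_)
  rw [norm_mul, hz, one_mul]

theorem continuous_tent_mul (N δ ξ : ℝ) :
    Continuous fun η => tent N δ η * tent N δ (ξ - η) :=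
  (continuous_tent N δ).mul ((continuous_tent N δ).comp (by fun_prop))

theorem integrable_tent_mul (hδ : 0 < δ) (ξ : ℝ) :
    Integrable fun η => tent N δ η * tent N δ (ξ - η) := by
  refine (continuous_tent_mul N δ ξ).integrable_of_hasCompactSupport ?_
  have h : HasCompactSupport fun ξ => tent N δ ξ := by
    refine (hasCompactSupport_tent (N := N) hδ).comp_left (g := Complex.re) (by simp)
  exact h.mul_right

theorem le_integral_tent_mul (hδ : 0 < δ) (hδN : δ ≤ N) {ξ : ℝ}
    (hξ : |ξ - 2 * N| ≤ δ / 2) : δ / 16 ≤ ∫ η, tent N δ η * tent N δ (ξ - η) := by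
  have hξ' := abs_le.mp hξ
  -- On this interval of length `δ/2` the tents are at least `3/4` and `1/4`, with product at least
  -- `1/8`.
  have hset : ∀ η ∈ Icc (N - δ / 4) (N + δ / 4),
      (1 / 8 : ℝ) ≤ tent N δ η * tent N δ (ξ - η) := by
    intro η hη
    have h1 : 3 / 4 ≤ tent N δ η := by
      refine le_max_of_le_right ?_
      have : |(|η| - N)| / δ ≤ 1 / 4 := by
        rw [div_le_iff₀ hδ, abs_of_nonneg (by linarith [hη.1] : 0 ≤ η), abs_le]
        constructor <;> linarith [hη.1, hη.2]
      linarith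
    have h2 : 1 / 4 ≤ tent N δ (ξ - η) := by
      refine le_max_of_le_right ?_
      have : |(|ξ - η| - N)| / δ ≤ 3 / 4 := by
        rw [div_le_iff₀ hδ, abs_of_nonneg (by linarith [hη.2] : 0 ≤ ξ - η), abs_le]
        constructor <;> linarith [hη.1, hη.2]
      linarith
    nlinarith
  calc δ / 16 = ∫ _ in Icc (N - δ / 4) (N + δ / 4), (1 / 8 : ℝ) := by
        rw [setIntegral_const, Real.volume_real_Icc_of_le (by linarith), smul_eq_mul]; ring
    _ ≤ ∫ η in Icc (N - δ / 4) (N + δ / 4), tent N δ η * tent N δ (ξ - η) :=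
        setIntegral_mono_on (integrableOn_const (by simp)) (integrable_tent_mul hδ ξ).integrableOn
          measurableSet_Icc hset
    _ ≤ _ := setIntegral_le_integral (integrable_tent_mul hδ ξ)
        (Filter.Eventually.of_forall fun η => mul_nonneg (tent_nonneg _ _ _) (tent_nonneg _ _ _))

/-- For output near `2N` both inputs must lie in the bump at `+N`; then `ξ - 2η = (ξ - 2N) + 2(N -
η)` is at most `δ/2 + 2δ` in modulus. -/
theorem abs_sub_two_mul_le (hN : 1 ≤ N) (hδ : 0 < δ) (hδ' : δ ≤ 1 / 2) {ξ η : ℝ}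
    (hξ : |ξ - 2 * N| ≤ δ / 2) (h1 : tent N δ η ≠ 0) (h2 : tent N δ (ξ - η) ≠ 0) :
    |ξ - 2 * η| ≤ 5 / 2 * δ := by
  have a1 := abs_lt.mp (abs_lt_of_tent_ne_zero hδ h1)
  have a2 := abs_lt.mp (abs_lt_of_tent_ne_zero hδ h2)
  have hξ' := abs_le.mp hξ
  have hη : 0 ≤ η := by linarith [le_abs_self (ξ - η)]
  rw [abs_of_nonneg hη] at a1
  rw [abs_le]
  constructor <;> linarith

theorem half_le_cos (hT : 0 ≤ T) (hN : 1 ≤ N) (hδ : 0 < δ) (hδ' : δ ≤ 1 / 2)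
    (hphase : 57 * T * (2 * Real.pi) ^ 3 * (N * δ ^ 2) ≤ 1) {ξ η τ : ℝ} (hτ : τ ∈ Icc 0 T)
    (hξ : |ξ - 2 * N| ≤ δ / 2) (h : |ξ - 2 * η| ≤ 5 / 2 * δ) :
    1 / 2 ≤ Real.cos (τ * ((2 * Real.pi) ^ 3 * (3 * ξ * (ξ - 2 * η) ^ 2))) := by
  have hξ' := abs_le.mp hξ
  have hsq : (ξ - 2 * η) ^ 2 ≤ (5 / 2 * δ) ^ 2 := by
    rw [← sq_abs]; exact pow_le_pow_left₀ (abs_nonneg _) h 2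
  have hξ0 : 0 ≤ ξ := by linarith
  have hpi := Real.pi_pos
  have h0 : 0 ≤ τ * ((2 * Real.pi) ^ 3 * (3 * ξ * (ξ - 2 * η) ^ 2)) := by
    have := hτ.1
    positivity
  have hle : τ * ((2 * Real.pi) ^ 3 * (3 * ξ * (ξ - 2 * η) ^ 2)) ≤ 1 := by
    -- With `ξ ≤ 3N` the numerical factor is `9 · 25/4 = 56.25`, rounded up to the `57` of `hphase`.
    -- A phase in `[0, 1]` has cosine at least `1/2`.
    calc τ * ((2 * Real.pi) ^ 3 * (3 * ξ * (ξ - 2 * η) ^ 2))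
        ≤ T * ((2 * Real.pi) ^ 3 * (3 * (3 * N) * (5 / 2 * δ) ^ 2)) := by
          gcongr
          · exact hτ.2
          · linarith
      _ = 56.25 * (T * (2 * Real.pi) ^ 3 * (N * δ ^ 2)) := by ring
      _ ≤ 57 * (T * (2 * Real.pi) ^ 3 * (N * δ ^ 2)) := by
          gcongr; norm_num
      _ ≤ 1 := by linarith
  have := Real.one_sub_sq_div_two_le_cos (x := τ * ((2 * Real.pi) ^ 3 * (3 * ξ * (ξ - 2 * η) ^ 2)))
  nlinarith

theorem le_norm_duhamel (hT : 0 ≤ T) (hN : 1 ≤ N) (hδ : 0 < δ) (hδ' : δ ≤ 1 / 2)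
    (hphase : 57 * T * (2 * Real.pi) ^ 3 * (N * δ ^ 2) ≤ 1) {A : Amp}
    (hA : ∀ t ∈ Icc 0 T, ∀ ξ, coef T A t ξ = airy 4 t ξ * (tent N δ ξ : ℂ)) {ξ : ℝ}
    (hξ : |ξ - 2 * N| ≤ δ / 2) : T * (N * δ / 8) ≤ ‖duhamel T 1 A A T ξ‖ := by
  have hξ' := abs_le.mp hξ
  have hξ0 : N ≤ ξ := by linarith
  -- This rotation cancels the `-I` of the derivative and the propagator at time `T`, leaving the
  -- resonant phase, whose real part is bounded below at every `τ`.
  refine mul_le_norm_integral hT (z := Complex.I * airy 1 (-T) ξ) (by simp [norm_airy])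
    (intervalIntegrable_duhamel hT 1 A A T ξ 0 T) fun τ hτ => ?_
  have e1 : Complex.I * airy 1 (-T) ξ * (airy 1 (T - τ) ξ * src T A A τ ξ)
      = ((2 * Real.pi * ξ : ℝ) : ℂ) * ∫ η, airy 1 (-τ) ξ * (coef T A τ η * coef T A τ (ξ - η)) := by
    have a : airy 1 (-τ) ξ = airy 1 (-T) ξ * airy 1 (T - τ) ξ := by rw [← airy_add]; ring_nf
    rw [integral_const_mul, src, conv, a]
    push_cast
    linear_combination (-(2 * Real.pi * ξ * (airy 1 (-T) ξ * airy 1 (T - τ) ξ)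
      * ∫ η, coef T A τ η * coef T A τ (ξ - η)) : ℂ) * Complex.I_sq
  have hint := (integrable_coef_mul_coef hT A A τ ξ).const_mul (airy 1 (-τ) ξ)
  have e2 : (∫ η, airy 1 (-τ) ξ * (coef T A τ η * coef T A τ (ξ - η))).re
      = ∫ η, (airy 1 (-τ) ξ * (coef T A τ η * coef T A τ (ξ - η))).re :=
    (Complex.reCLM.integral_comp_comm hint).symm
  have e3 : ∀ η, (airy 1 (-τ) ξ * (coef T A τ η * coef T A τ (ξ - η))).re
      = tent N δ η * tent N δ (ξ - η)
        * Real.cos (τ * ((2 * Real.pi) ^ 3 * (3 * ξ * (ξ - 2 * η) ^ 2))) := by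
    intro η
    rw [hA τ hτ, hA τ hτ, show airy 1 (-τ) ξ * (airy 4 τ η * (tent N δ η : ℂ)
      * (airy 4 τ (ξ - η) * (tent N δ (ξ - η) : ℂ)))
      = ((tent N δ η * tent N δ (ξ - η) : ℝ) : ℂ)
        * (airy 1 (-τ) ξ * (airy 4 τ η * airy 4 τ (ξ - η))) by push_cast; ring,
      airy_product, re_ofReal_mul, Complex.exp_ofReal_mul_I_re]
  rw [e1, re_ofReal_mul, e2]
  have hge : (1 / 2) * (δ / 16) ≤ ∫ η, (airy 1 (-τ) ξ * (coef T A τ η * coef T A τ (ξ - η))).re := by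
    refine (mul_le_mul_of_nonneg_left (le_integral_tent_mul hδ (by linarith) hξ)
      (by norm_num)).trans ?_
    rw [← integral_const_mul]
    refine integral_mono ((integrable_tent_mul hδ ξ).const_mul _) hint.re fun η => ?_
    change _ ≤ (airy 1 (-τ) ξ * (coef T A τ η * coef T A τ (ξ - η))).re
    rw [e3, mul_comm]
    by_cases h1 : tent N δ η = 0
    · simp [h1]
    by_cases h2 : tent N δ (ξ - η) = 0
    · simp [h2]
    exact mul_le_mul_of_nonneg_left
      (half_le_cos hT hN hδ hδ' hphase hτ hξ (abs_sub_two_mul_le hN hδ hδ' hξ h1 h2))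
      (mul_nonneg (tent_nonneg _ _ _) (tent_nonneg _ _ _))
  calc N * δ / 8 ≤ 2 * Real.pi * ξ * (1 / 2 * (δ / 16)) := by
        have := Real.pi_gt_three
        have h1 : N * δ ≤ ξ * δ := mul_le_mul_of_nonneg_right hξ0 hδ.le
        have h2 : 0 ≤ N * δ := by positivity
        have h3 : 2 * (ξ * δ) ≤ Real.pi * (ξ * δ) :=
          mul_le_mul_of_nonneg_right (by linarith) (h2.trans h1)
        linarith
    _ ≤ _ := mul_le_mul_of_nonneg_left hge
        (mul_nonneg Real.two_pi_pos.le (by linarith))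

/-! ### Norms of the data and of the iterate, choice of scales -/

theorem rpow_bounds (s : ℝ) {y : ℝ} (h1 : 1 / 10 ≤ y) (h2 : y ≤ 10) :
    ((10 : ℝ) ^ |s|)⁻¹ ≤ y ^ s ∧ y ^ s ≤ (10 : ℝ) ^ |s| := by
  have hy : 0 < y := by linarith
  have hlog : |Real.log y| ≤ Real.log 10 := by
    rw [abs_le]
    constructor
    · rw [← Real.log_inv]
      exact Real.log_le_log (by norm_num) (by linarith)
    · exact Real.log_le_log hy h2
  have habs : |Real.log y * s| ≤ Real.log 10 * |s| := by
    rw [abs_mul]; gcongr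
  rw [Real.rpow_def_of_pos hy, Real.rpow_def_of_pos (by norm_num : (0 : ℝ) < 10), ← Real.exp_neg]
  exact ⟨Real.exp_le_exp.mpr (abs_le.mp habs).1, Real.exp_le_exp.mpr (abs_le.mp habs).2⟩

theorem weight_bounds (s : ℝ) (hN : 1 ≤ N) {ξ : ℝ} (h1 : N / 2 ≤ |ξ|) (h2 : |ξ| ≤ 3 * N) :
    ((10 : ℝ) ^ |s|)⁻¹ * (N ^ 2) ^ s ≤ (1 + ξ ^ 2) ^ s ∧
      (1 + ξ ^ 2) ^ s ≤ (10 : ℝ) ^ |s| * (N ^ 2) ^ s := by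
  have hN0 : 0 < N ^ 2 := by positivity
  have a1 : (N / 2) ^ 2 ≤ ξ ^ 2 := by
    rw [← sq_abs ξ]; exact pow_le_pow_left₀ (by linarith) h1 2
  have a2 : ξ ^ 2 ≤ (3 * N) ^ 2 := by
    rw [← sq_abs ξ]; exact pow_le_pow_left₀ (abs_nonneg _) h2 2
  have e : (1 + ξ ^ 2) ^ s = ((1 + ξ ^ 2) / N ^ 2) ^ s * (N ^ 2) ^ s := by
    rw [← Real.mul_rpow (by positivity) hN0.le]
    congr 1
    field_simp
  obtain ⟨b1, b2⟩ := rpow_bounds s (y := (1 + ξ ^ 2) / N ^ 2)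
    (by rw [le_div_iff₀ hN0]; nlinarith) (by rw [div_le_iff₀ hN0]; nlinarith)
  rw [e]
  have : 0 ≤ (N ^ 2) ^ s := by positivity
  exact ⟨mul_le_mul_of_nonneg_right b1 this, mul_le_mul_of_nonneg_right b2 this⟩

/-- Two bumps, each supported on an interval of length `2δ` where the Sobolev weight is comparable
to `N^(2s)`. -/
theorem integral_tent_le (s : ℝ) (hN : 1 ≤ N) (hδ : 0 < δ) (hδ' : δ ≤ 1 / 2) :
    ∫ ξ, (1 + ξ ^ 2) ^ s * ‖(tent N δ ξ : ℂ)‖ ^ 2 ≤ (10 : ℝ) ^ |s| * (N ^ 2) ^ s * (4 * δ) := by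
  set D := (10 : ℝ) ^ |s| * (N ^ 2) ^ s with hD
  have hD0 : 0 ≤ D := by positivity
  have hle : ∀ ξ, (1 + ξ ^ 2) ^ s * ‖(tent N δ ξ : ℂ)‖ ^ 2
      ≤ (Icc (N - δ) (N + δ)).indicator (fun _ => D) ξ
        + (Icc (-N - δ) (-N + δ)).indicator (fun _ => D) ξ := by
    intro ξ
    have hi1 : 0 ≤ (Icc (N - δ) (N + δ)).indicator (fun _ => D) ξ :=
      indicator_nonneg (fun _ _ => hD0) ξ
    have hi2 : 0 ≤ (Icc (-N - δ) (-N + δ)).indicator (fun _ => D) ξ :=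
      indicator_nonneg (fun _ _ => hD0) ξ
    by_cases h : tent N δ ξ = 0
    · rw [h]; simpa using add_nonneg hi1 hi2
    have a := abs_lt.mp (abs_lt_of_tent_ne_zero hδ h)
    have hw : (1 + ξ ^ 2) ^ s * ‖(tent N δ ξ : ℂ)‖ ^ 2 ≤ D := by
      have b := (weight_bounds s hN (ξ := ξ) (by linarith) (by linarith)).2
      have c : ‖(tent N δ ξ : ℂ)‖ ^ 2 ≤ 1 := by
        rw [Complex.norm_real, Real.norm_of_nonneg (tent_nonneg _ _ _)]
        exact pow_le_one₀ (tent_nonneg _ _ _) (tent_le_one hδ ξ)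
      exact (mul_le_of_le_one_right (by positivity) c).trans b
    rcases le_total 0 ξ with h0 | h0
    · rw [abs_of_nonneg h0] at a
      have : ξ ∈ Icc (N - δ) (N + δ) := ⟨by linarith, by linarith⟩
      rw [indicator_of_mem this]
      linarith
    · rw [abs_of_nonpos h0] at a
      have : ξ ∈ Icc (-N - δ) (-N + δ) := ⟨by linarith, by linarith⟩
      rw [indicator_of_mem this]
      linarith
  have hI : ∀ a b : ℝ, Integrable ((Icc a b).indicator fun _ => D) := fun a b =>
    (integrable_indicator_iff measurableSet_Icc).mpr (integrableOn_const (by simp))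
  have hint : Integrable fun ξ => (1 + ξ ^ 2) ^ s * ‖(tent N δ ξ : ℂ)‖ ^ 2 :=
    (expDecay_of_hasCompactSupport (Complex.continuous_ofReal.comp (continuous_tent N δ))
      (hasCompactSupport_tent hδ)).integrable_weight s
  refine (integral_mono hint ((hI _ _).add (hI _ _)) hle).trans_eq ?_
  rw [integral_add' (hI _ _) (hI _ _), integral_indicator measurableSet_Icc,
    integral_indicator measurableSet_Icc, setIntegral_const, setIntegral_const,
    Real.volume_real_Icc_of_le (by linarith), Real.volume_real_Icc_of_le (by linarith),
    smul_eq_mul, smul_eq_mul]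
  ring

theorem le_integral_duhamel (s : ℝ) (hT : 0 ≤ T) (hN : 1 ≤ N) (hδ : 0 < δ) (hδ' : δ ≤ 1 / 2)
    (hphase : 57 * T * (2 * Real.pi) ^ 3 * (N * δ ^ 2) ≤ 1) {A : realAmp}
    (hA : ∀ t ∈ Icc 0 T, ∀ ξ, coef T A t ξ = airy 4 t ξ * (tent N δ ξ : ℂ)) :
    δ * (((10 : ℝ) ^ |s|)⁻¹ * (N ^ 2) ^ s * (T * (N * δ / 8) / 2) ^ 2)
      ≤ ∫ ξ, (1 + ξ ^ 2) ^ s * ‖(1 / 2 : ℂ) * duhamel T 1 A A T ξ‖ ^ 2 := by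
  have hTmem : T ∈ Icc 0 T := ⟨hT, le_rfl⟩
  have hint : Integrable fun ξ => (1 + ξ ^ 2) ^ s * ‖(1 / 2 : ℂ) * duhamel T 1 A A T ξ‖ ^ 2 := by
    have h := (expDecay_coef hT ((1 / 2 : ℝ) • duhamelAmp hT 1 A A : realAmp) T).integrable_weight s
    refine h.congr (Filter.Eventually.of_forall fun ξ => ?_)
    simp only [Submodule.coe_smul, coef_smul, coef_duhamelAmp hT 1 A A hTmem]
    norm_num
  calc δ * (((10 : ℝ) ^ |s|)⁻¹ * (N ^ 2) ^ s * (T * (N * δ / 8) / 2) ^ 2)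
      = ∫ _ in Icc (2 * N - δ / 2) (2 * N + δ / 2),
          ((10 : ℝ) ^ |s|)⁻¹ * (N ^ 2) ^ s * (T * (N * δ / 8) / 2) ^ 2 := by
        rw [setIntegral_const, Real.volume_real_Icc_of_le (by linarith), smul_eq_mul]; ring
    _ ≤ ∫ ξ in Icc (2 * N - δ / 2) (2 * N + δ / 2),
          (1 + ξ ^ 2) ^ s * ‖(1 / 2 : ℂ) * duhamel T 1 A A T ξ‖ ^ 2 := by
        refine setIntegral_mono_on (integrableOn_const (by simp)) hint.integrableOn
          measurableSet_Icc fun ξ hξ => ?_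
        have h1 := le_norm_duhamel hT hN hδ hδ' hphase hA (ξ := ξ)
          (abs_le.mpr ⟨by linarith [hξ.1], by linarith [hξ.2]⟩)
        have h0 : 0 ≤ ξ := by linarith [hξ.1]
        have h2 := (weight_bounds s hN (ξ := ξ) (by rw [abs_of_nonneg h0]; linarith [hξ.1])
          (by rw [abs_of_nonneg h0]; linarith [hξ.2])).1
        have h3 : T * (N * δ / 8) / 2 ≤ ‖(1 / 2 : ℂ) * duhamel T 1 A A T ξ‖ := by
          rw [norm_mul]
          norm_num
          linarith
        gcongr
    _ ≤ _ := setIntegral_le_integral hint (Filter.Eventually.of_forall fun ξ => by positivity)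

/-- With `δ = κ N^(-1/2)`, the scale that keeps the phase bounded, `N² δ = κ N^(3/2)` outgrows
`N^(2s)` because `2s < 3/2`. -/
theorem exists_large_frequency {s κ : ℝ} (hs : s < 3 / 4) (hκ : 0 < κ) (D : ℝ) :
    ∃ N δ : ℝ, 1 ≤ N ∧ 0 < δ ∧ δ ≤ κ ∧ N * δ ^ 2 = κ ^ 2 ∧ D * (N ^ 2) ^ s < N ^ 2 * δ := by
  have hlim := tendsto_rpow_atTop (by linarith : 0 < 3 / 2 - 2 * s)
  obtain ⟨N, hN1, hN⟩ := ((Filter.eventually_ge_atTop (1 : ℝ)).and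
    (hlim.eventually_gt_atTop (D / κ))).exists
  have hN0 : 0 < N := by linarith
  refine ⟨N, κ * N ^ (-(1 / 2) : ℝ), hN1, by positivity, ?_, ?_, ?_⟩
  · exact mul_le_of_le_one_right hκ.le (Real.rpow_le_one_of_one_le_of_nonpos hN1 (by norm_num))
  · have : (N ^ (-(1 / 2) : ℝ)) ^ 2 = N⁻¹ := by
      rw [← Real.rpow_natCast, ← Real.rpow_mul hN0.le, ← Real.rpow_neg_one]
      norm_num
    rw [mul_pow, this]
    field_simp
  · have e1 : (N ^ 2) ^ s = N ^ (2 * s) := by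
      rw [← Real.rpow_natCast, ← Real.rpow_mul hN0.le]; norm_num
    have e2 : N ^ 2 * (κ * N ^ (-(1 / 2) : ℝ)) = κ * (N ^ (3 / 2 - 2 * s) * N ^ (2 * s)) := by
      rw [← Real.rpow_add hN0, ← Real.rpow_natCast, mul_left_comm, ← Real.rpow_add hN0]
      congr 2
      push_cast; ring
    rw [e1, e2, ← mul_assoc]
    refine mul_lt_mul_of_pos_right ?_ (by positivity)
    rw [div_lt_iff₀ hκ] at hN
    linarith

end

end MajdaBiello


/-! ### Contradiction at high frequency -/

theorem propositionA1 (𝔽 : Subalgebra ℝ ℂ) (s : ℝ) (hs : s < 3 / 4) :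
    ¬ MajdaBiello.IsLocallyWellPosed 2 𝔽 4 0 s := by
  intro h
  obtain ⟨T, hT, C, hC, hquad⟩ := h.exists_quadratic_estimate
  have hpi := Real.pi_pos
  obtain ⟨κ, hκ0, hκ1, hκ2⟩ : ∃ κ : ℝ, 0 < κ ∧ κ ≤ 1 / 2 ∧
      57 * T * (2 * Real.pi) ^ 3 * κ ^ 2 ≤ 1 := by
    have ha : 0 < 57 * T * (2 * Real.pi) ^ 3 := by positivity
    have hlim : Filter.Tendsto (fun κ : ℝ => 57 * T * (2 * Real.pi) ^ 3 * κ ^ 2) (𝓝[>] 0) (𝓝 0) := by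
      have : Continuous fun κ : ℝ => 57 * T * (2 * Real.pi) ^ 3 * κ ^ 2 := by fun_prop
      simpa using (this.tendsto 0).mono_left nhdsWithin_le_nhds
    obtain ⟨κ, ⟨h1, h2⟩, h3⟩ := (((hlim.eventually (gt_mem_nhds one_pos)).and
      (nhdsWithin_le_nhds (gt_mem_nhds (by norm_num : (0 : ℝ) < 1 / 2)))).and
        self_mem_nhdsWithin).exists
    exact ⟨κ, h3, h2.le, h1.le⟩
  obtain ⟨N, δ, hN, hδ, hδκ, hNδ, hlarge⟩ := MajdaBiello.exists_large_frequency hs hκ0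
    -- Here `4096 = 16² · 4²`, from the factor `1/16` in the iterate's lower bound and the support
    -- length `4δ`; the cube collects one weight comparison for the iterate and two for the squared
    -- data norm.
    (4096 * C * ((10 : ℝ) ^ |s|) ^ 3 / T ^ 2)
  have hδ' : δ ≤ 1 / 2 := hδκ.trans hκ1
  have hg : Continuous fun ξ => (MajdaBiello.tent N δ ξ : ℂ) :=
    Complex.continuous_ofReal.comp (MajdaBiello.continuous_tent N δ)
  have hc := MajdaBiello.hasCompactSupport_tent (N := N) hδ
  have hg' : ∀ ξ, (MajdaBiello.tent N δ (-ξ) : ℂ)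
      = starRingEnd ℂ (MajdaBiello.tent N δ ξ : ℂ) := fun ξ => by
    rw [MajdaBiello.tent_neg, Complex.conj_ofReal]
  obtain ⟨A, hA⟩ := MajdaBiello.exists_free_amp hT.le hg hc hg'
  have h1 := MajdaBiello.le_integral_duhamel s hT.le hN hδ hδ' (by rw [hNδ]; exact hκ2) hA
  have h2 := hquad _ hg hc hg' A hA
  have h3 := pow_le_pow_left₀ (integral_nonneg fun ξ => by positivity)
    (MajdaBiello.integral_tent_le s hN hδ hδ') 2
  have h4 := h1.trans (h2.trans (mul_le_mul_of_nonneg_left h3 hC))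
  have hP : 0 < (10 : ℝ) ^ |s| := by positivity
  have hW : 0 < (N ^ 2) ^ s := by positivity
  generalize (10 : ℝ) ^ |s| = P at *
  generalize (N ^ 2) ^ s = W at *
  rw [div_mul_eq_mul_div, div_lt_iff₀ (by positivity)] at hlarge
  have h5 : (W * δ ^ 2) * (N ^ 2 * δ * T ^ 2) ≤ (W * δ ^ 2) * (4096 * C * P ^ 3 * W) := by
    have e := mul_le_mul_of_nonneg_left h4 (by positivity : 0 ≤ 256 * P)
    have e1 : 256 * P * (δ * (P⁻¹ * W * (T * (N * δ / 8) / 2) ^ 2))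
        = (W * δ ^ 2) * (N ^ 2 * δ * T ^ 2) := by field_simp; ring
    have e2 : 256 * P * (C * (P * W * (4 * δ)) ^ 2) = (W * δ ^ 2) * (4096 * C * P ^ 3 * W) := by ring
    rwa [e1, e2] at e
  exact absurd (le_of_mul_le_mul_left h5 (by positivity)) (not_le.mpr hlarge)
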